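/- For every $\varepsilon_0 > 0$ there exist an $\varepsilon \in (0, \varepsilon_0)$ and a finite non-empty set $X \subseteq \mathbb{R}^2$ such that the smallest size of an $\varepsilon$-net for the family of intersections of straight lines with $X$ is at least \[ \frac{1}{80\varepsilon} \cdot \sqrt{\frac{\log(1/\varepsilon)}{\log\log(1/\varepsilon)}}. \] Here $\log$ is the natural logarithm, and an $\varepsilon$-net for this family is a set $N \subseteq X$ such that $N \cap \ell \neq \emptyset$ for every straight line $\ell \subseteq \mathbb{R}^2$ with $|\ell \cap X| \ge \varepsilon |X|$. -/

import Mathlib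

/-- `N` is an `ε`-net for the finite set `X` and the collection `R` of subsets of `X`: `N ⊆ X` and
`N` meets every member of `R` that has at least `ε |X|` elements. -/
def IsEpsNet {α : Type*} (ε : ℝ) (X : Finset α) (R : Set (Finset α)) (N : Finset α) : Prop :=
  N ⊆ X ∧ ∀ A ∈ R, ε * (X.card : ℝ) ≤ (A.card : ℝ) → ∃ x ∈ N, x ∈ A

/-- The range space of lines on a finite planar set `X`: all intersections of `X` with straight
lines (one-dimensional affine subspaces of the plane). -/
def lineRanges (X : Finset (EuclideanSpace ℝ (Fin 2))) :
    Set (Finset (EuclideanSpace ℝ (Fin 2))) :=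
  {A | ∃ L : AffineSubspace ℝ (EuclideanSpace ℝ (Fin 2)),
    Module.finrank ℝ L.direction = 1 ∧
      (A : Set (EuclideanSpace ℝ (Fin 2))) = (X : Set (EuclideanSpace ℝ (Fin 2))) ∩ L}

/-! Fix a large `r`. The goal is a grid subset `X` with at most `r` points on each grid line such
that every `Y ⊆ X` with at least `h` points, where `3h ≤ 2|X|`, contains `r` points of some grid
line (`exists_grid_subset`). For `ε = r / |X|` the complement of a net contains no such `r` points,
so a net has at least `|X| / 4 = r / (4ε)` points. Since `|X| ≤ r ^ (13 r²)`, the square root in the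
bound is at most `20 r`.

`X` is a random sample of `2h` grid points with a few deleted (`exists_sample`). A union bound over
all free sets, those with fewer than `r` points on each line, would be too costly. Instead they are
enclosed in at most `2 ^ (2h)` containers of density at most `1/64`
(`coveredBy_freeSets_grid_univ`); the sample puts `h` points into a given one with probability at
most `2 ^ (-4h)`.

Containers come from `coveredBy_freeSets`, for linear hypergraphs with edges of size `q`. Phase `j`
keeps a small `S ⊆ Y` and a probability distribution on edges that meet `S` in at least `j` points,
with a degree vector of small `ℓ²` norm. Small norm makes every set carrying a `1/(4r)` share of the
degrees large, in particular the set of good vertices. Either `Y` misses all good vertices outside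
`S`, and removing them gives a container, or a good vertex of `Y` joins `S`. After `s` such vertices
the average of their links is the next distribution. A good link correlates with the previous ones
barely more than an average link does, and linearity bounds its own norm, so a phase multiplies the
norm bound by only `1 + 4/r`, hence all phases by a constant. Once the edges have `r - 1` points in
`S`, a free `Y` avoids their other vertices. -/

set_option linter.unusedSectionVars false

/-! ### Weighted linear hypergraphs -/

/-- The weighted degree of the vertex `u`, for weights `w` on the edges `e`. -/
noncomputable def wdeg {V ι : Type*} [DecidableEq V] [Fintype ι] (e : ι → Finset V) (w : ι → ℝ)
    (u : V) : ℝ :=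
  ∑ i, if u ∈ e i then w i else 0

/-- The weights `w` restricted to the edges through `y`, normalised to total weight one. -/
noncomputable def linkWeight {V ι : Type*} [DecidableEq V] [Fintype ι] (e : ι → Finset V)
    (w : ι → ℝ) (y : V) (i : ι) : ℝ :=
  if y ∈ e i then w i / wdeg e w y else 0

section Weights

variable {V ι : Type*} [Fintype V] [DecidableEq V] [Fintype ι] {e : ι → Finset V} {w : ι → ℝ}

theorem wdeg_nonneg (hw : ∀ i, 0 ≤ w i) (u : V) : 0 ≤ wdeg e w u :=
  Finset.sum_nonneg fun i _ => by split_ifs <;> simp [hw i]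

theorem linkWeight_nonneg (hw : ∀ i, 0 ≤ w i) (y : V) (i : ι) : 0 ≤ linkWeight e w y i := by
  unfold linkWeight
  split_ifs
  · exact div_nonneg (hw i) (wdeg_nonneg hw y)
  · exact le_rfl

theorem sum_wdeg {q : ℕ} (hq : ∀ i, (e i).card = q) : ∑ u, wdeg e w u = q * ∑ i, w i := by
  unfold wdeg
  rw [Finset.sum_comm, Finset.mul_sum]
  refine Finset.sum_congr rfl fun i _ => ?_
  rw [← Finset.sum_filter, Finset.sum_const, Finset.filter_mem_eq_inter, Finset.univ_inter, hq,
    nsmul_eq_mul]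

theorem sum_linkWeight {y : V} (hy : wdeg e w y ≠ 0) : ∑ i, linkWeight e w y i = 1 := by
  have : ∑ i, linkWeight e w y i = (∑ i, if y ∈ e i then w i else 0) / wdeg e w y := by
    rw [Finset.sum_div]
    refine Finset.sum_congr rfl fun i _ => ?_
    unfold linkWeight
    split_ifs <;> simp
  rw [this]
  exact div_self hy

theorem le_wdeg (hw : ∀ i, 0 ≤ w i) {y : V} {i : ι} (hy : y ∈ e i) : w i ≤ wdeg e w y := by
  have := Finset.single_le_sum (f := fun i => if y ∈ e i then w i else 0)
    (fun i _ => by split_ifs <;> simp [hw i]) (Finset.mem_univ i)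
  simpa [hy, wdeg] using this

theorem wdeg_mul_linkWeight (hw : ∀ i, 0 ≤ w i) (y : V) (i : ι) :
    wdeg e w y * linkWeight e w y i = if y ∈ e i then w i else 0 := by
  unfold linkWeight
  split_ifs with h
  · by_cases h0 : wdeg e w y = 0
    · have := le_wdeg hw h
      rw [h0] at this ⊢
      simp [le_antisymm this (hw i)]
    · field_simp
  · simp

/-- Averaging the degrees of the links over the degree distribution gives back the degrees. -/
theorem sum_wdeg_mul_wdeg_linkWeight {q : ℕ} (hq : ∀ i, (e i).card = q) (hw : ∀ i, 0 ≤ w i)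
    (u : V) : ∑ y, wdeg e w y * wdeg e (linkWeight e w y) u = q * wdeg e w u := by
  have h1 : ∀ y, wdeg e w y * wdeg e (linkWeight e w y) u =
      ∑ i, if u ∈ e i then (if y ∈ e i then w i else 0) else 0 := by
    intro y
    conv_lhs => rw [wdeg.eq_1 e (linkWeight e w y), Finset.mul_sum]
    refine Finset.sum_congr rfl fun i _ => ?_
    rw [← wdeg_mul_linkWeight hw]
    split_ifs <;> simp
  simp_rw [h1]
  rw [Finset.sum_comm, wdeg, Finset.mul_sum]
  refine Finset.sum_congr rfl fun i _ => ?_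
  split_ifs
  · rw [← Finset.sum_filter, Finset.sum_const, Finset.filter_mem_eq_inter, Finset.univ_inter, hq,
      nsmul_eq_mul]
  · simp

/-- By linearity at most one edge contains both `u` and `y`, so the degree in the link is at most
one quotient `w i / wdeg e w y`. -/
theorem wdeg_linkWeight_le {M : ℝ} (hw : ∀ i, 0 ≤ w i) (hM : ∀ i, w i ≤ M)
    (hlin : ∀ i j u v, u ≠ v → u ∈ e i → v ∈ e i → u ∈ e j → v ∈ e j → i = j)
    {y u : V} (huy : u ≠ y) (hM0 : 0 ≤ M) :
    wdeg e (linkWeight e w y) u ≤ M / wdeg e w y := by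
  have hd := wdeg_nonneg (e := e) hw y
  by_cases h : ∃ i, u ∈ e i ∧ y ∈ e i
  · obtain ⟨i, hui, hyi⟩ := h
    unfold wdeg
    rw [Finset.sum_eq_single i]
    · simp only [hui, if_true, linkWeight, hyi]
      exact div_le_div_of_nonneg_right (hM i) hd
    · intro j _ hj
      split_ifs with huj
      · unfold linkWeight
        rw [if_neg]
        intro hyj
        exact hj (hlin j i u y huy huj hyj hui hyi)
      · rfl
    · simp
  · push Not at h
    have : wdeg e (linkWeight e w y) u = 0 := by
      refine Finset.sum_eq_zero fun i _ => ?_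
      split_ifs with hu
      · simp [linkWeight, h i hu]
      · rfl
    rw [this]
    positivity

theorem wdeg_linkWeight_le_one (hw : ∀ i, 0 ≤ w i) {y : V} (hy : wdeg e w y ≠ 0) (u : V) :
    wdeg e (linkWeight e w y) u ≤ 1 := by
  rw [← sum_linkWeight hy]
  refine Finset.sum_le_sum fun i _ => ?_
  split_ifs
  · exact le_rfl
  · exact linkWeight_nonneg hw y i

/-- The centre `y` accounts for the summand `1`. The other vertices have total degree at most `q` in
the link, and the second moment is at most total times maximum. -/
theorem sum_sq_wdeg_linkWeight_le {q : ℕ} {M : ℝ} (hq : ∀ i, (e i).card = q) (hw : ∀ i, 0 ≤ w i)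
    (hM : ∀ i, w i ≤ M) (hM0 : 0 ≤ M)
    (hlin : ∀ i j u v, u ≠ v → u ∈ e i → v ∈ e i → u ∈ e j → v ∈ e j → i = j)
    {y : V} (hy : wdeg e w y ≠ 0) :
    ∑ u, wdeg e (linkWeight e w y) u ^ 2 ≤ 1 + q * (M / wdeg e w y) := by
  have hl := linkWeight_nonneg (e := e) hw y
  have hx : ∀ u, 0 ≤ wdeg e (linkWeight e w y) u := wdeg_nonneg hl
  have hd := wdeg_nonneg (e := e) hw y
  have hs : ∑ u, wdeg e (linkWeight e w y) u = q := by
    rw [sum_wdeg hq, sum_linkWeight hy, mul_one]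
  rw [← Finset.add_sum_erase _ _ (Finset.mem_univ y)]
  have h1 := wdeg_linkWeight_le_one hw hy y
  have h2 : ∑ u ∈ Finset.univ.erase y, wdeg e (linkWeight e w y) u ^ 2 ≤
      ∑ u ∈ Finset.univ.erase y, wdeg e (linkWeight e w y) u * (M / wdeg e w y) := by
    refine Finset.sum_le_sum fun u hu => ?_
    rw [sq]
    exact mul_le_mul_of_nonneg_left
      (wdeg_linkWeight_le hw hM hlin (Finset.ne_of_mem_erase hu) hM0) (hx u)
  have h3 : ∑ u ∈ Finset.univ.erase y, wdeg e (linkWeight e w y) u ≤ q := by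
    rw [← hs]
    exact Finset.sum_le_sum_of_subset_of_nonneg (Finset.erase_subset _ _) fun u _ _ => hx u
  rw [← Finset.sum_mul] at h2
  have h4 := mul_le_mul_of_nonneg_right h3 (div_nonneg hM0 hd)
  have h5 : wdeg e (linkWeight e w y) y ^ 2 ≤ 1 := pow_le_one₀ (hx y) h1
  linarith

/-- A set carrying a `δ`-portion of the mass of `d` is large if `d` has small second moment. -/
theorem sq_le_card_mul_of_le_sum {d : V → ℝ} {a δ : ℝ} (ha : ∑ u, d u ^ 2 ≤ a ^ 2) (hδ : 0 ≤ δ)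
    {G : Finset V} (hG : δ ≤ ∑ u ∈ G, d u) : δ ^ 2 ≤ G.card * a ^ 2 := by
  have h1 : (∑ u ∈ G, d u) ^ 2 ≤ G.card * ∑ u ∈ G, d u ^ 2 := sq_sum_le_card_mul_sum_sq
  have h2 : ∑ u ∈ G, d u ^ 2 ≤ ∑ u, d u ^ 2 :=
    Finset.sum_le_sum_of_subset_of_nonneg (Finset.subset_univ _) fun u _ _ => sq_nonneg _
  calc δ ^ 2 ≤ (∑ u ∈ G, d u) ^ 2 := pow_le_pow_left₀ hδ hG 2
    _ ≤ _ := h1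
    _ ≤ _ := by gcongr; exact h2.trans ha

/-- The vertices `z` whose degree is not too small and whose link has almost minimal average
correlation with `f`. -/
noncomputable def goodSet (e : ι → Finset V) (w : ι → ℝ) (q r : ℕ) (f : V → ℝ) : Finset V :=
  {z | (q : ℝ) / (4 * r * Fintype.card V) ≤ wdeg e w z ∧
    ∑ u, f u * wdeg e (linkWeight e w z) u ≤ (1 + 1 / r) * ∑ u, f u * wdeg e w u}

/-- Under the degree distribution the link correlations average to `∑ f d`, where `d` is the degree
vector. By Markov, mass at least `q / (2r)` stays below `1 + 1/r` times this mean; vertices of low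
degree use up at most `q / (4r)` of it. -/
theorem le_sum_goodSet {q r : ℕ} (hr : 1 ≤ r) (hq : ∀ i, (e i).card = q) (hw : ∀ i, 0 ≤ w i)
    (hw1 : ∑ i, w i = 1) {f : V → ℝ} (hf : ∀ u, 0 ≤ f u) :
    (q : ℝ) / (4 * r) ≤ ∑ z ∈ goodSet e w q r f, wdeg e w z := by
  classical
  set d := wdeg e w with hd
  have hd0 : ∀ u, 0 ≤ d u := wdeg_nonneg hw
  have hr' : (1 : ℝ) ≤ r := by exact_mod_cast hr
  set T := ∑ u, f u * d u with hT
  have hT0 : 0 ≤ T := Finset.sum_nonneg fun u _ => mul_nonneg (hf u) (hd0 u)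
  set c : V → ℝ := fun z => ∑ u, f u * wdeg e (linkWeight e w z) u with hc
  have hc0 : ∀ z, 0 ≤ c z := fun z => Finset.sum_nonneg fun u _ =>
    mul_nonneg (hf u) (wdeg_nonneg (linkWeight_nonneg hw z) u)
  have havg : ∑ z, d z * c z = q * T := by
    simp only [hc, Finset.mul_sum, hT]
    rw [Finset.sum_comm]
    refine Finset.sum_congr rfl fun u _ => ?_
    have := sum_wdeg_mul_wdeg_linkWeight hq hw u
    calc ∑ z, d z * (f u * wdeg e (linkWeight e w z) u)
        = f u * ∑ z, d z * wdeg e (linkWeight e w z) u := by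
          rw [Finset.mul_sum]; exact Finset.sum_congr rfl fun z _ => by ring
      _ = _ := by rw [this]; ring
  have htot : ∑ z, d z = q := by rw [hd, sum_wdeg hq, hw1, mul_one]
  set Lo : Finset V := {z | d z < (q : ℝ) / (4 * r * Fintype.card V)} with hLo
  set Hi : Finset V := {z | (1 + 1 / (r : ℝ)) * T < c z} with hHi
  have hcover : Finset.univ ⊆ goodSet e w q r f ∪ (Lo ∪ Hi) := by
    intro z _
    simp only [goodSet, hLo, hHi, Finset.mem_union, Finset.mem_filter, Finset.mem_univ, true_and]
    by_cases h1 : d z < (q : ℝ) / (4 * r * Fintype.card V)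
    · exact Or.inr (Or.inl h1)
    · by_cases h2 : (1 + 1 / (r : ℝ)) * T < c z
      · exact Or.inr (Or.inr h2)
      · exact Or.inl ⟨not_lt.1 h1, not_lt.1 h2⟩
  have hsum : (q : ℝ) ≤ ∑ z ∈ goodSet e w q r f, d z + (∑ z ∈ Lo, d z + ∑ z ∈ Hi, d z) := by
    rw [← htot]
    refine (Finset.sum_le_sum_of_subset_of_nonneg hcover fun z _ _ => hd0 z).trans ?_
    have h1 := Finset.sum_union_inter (s₁ := goodSet e w q r f) (s₂ := Lo ∪ Hi) (f := d)
    have h2 := Finset.sum_union_inter (s₁ := Lo) (s₂ := Hi) (f := d)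
    have h3 : 0 ≤ ∑ z ∈ goodSet e w q r f ∩ (Lo ∪ Hi), d z := Finset.sum_nonneg fun z _ => hd0 z
    have h4 : 0 ≤ ∑ z ∈ Lo ∩ Hi, d z := Finset.sum_nonneg fun z _ => hd0 z
    linarith
  have hLos : ∑ z ∈ Lo, d z ≤ q / (4 * r) := by
    rcases isEmpty_or_nonempty V with hV | hV
    · have : Lo = ∅ := Finset.eq_empty_of_isEmpty _
      rw [this]; simp only [Finset.sum_empty]; positivity
    have hn : (0 : ℝ) < Fintype.card V := by exact_mod_cast Fintype.card_pos
    calc ∑ z ∈ Lo, d z ≤ ∑ z ∈ Lo, (q : ℝ) / (4 * r * Fintype.card V) :=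
          Finset.sum_le_sum fun z hz => (Finset.mem_filter.1 hz).2.le
      _ = Lo.card * ((q : ℝ) / (4 * r * Fintype.card V)) := by simp
      _ ≤ Fintype.card V * ((q : ℝ) / (4 * r * Fintype.card V)) := by
          gcongr; exact Finset.card_le_univ _
      _ = _ := by field_simp
  have hHis : (1 + 1 / (r : ℝ)) * ∑ z ∈ Hi, d z ≤ q := by
    have h1 : ∑ z ∈ Hi, d z * c z ≤ q * T := by
      rw [← havg]
      exact Finset.sum_le_sum_of_subset_of_nonneg (Finset.subset_univ _)
        fun z _ _ => mul_nonneg (hd0 z) (hc0 z)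
    rcases hT0.eq_or_lt with h0 | h0
    · have h2 : ∑ z ∈ Hi, d z = 0 := by
        refine Finset.sum_eq_zero fun z hz => ?_
        have h3 : d z * c z ≤ 0 := by
          have := Finset.single_le_sum (f := fun z => d z * c z)
            (fun z _ => mul_nonneg (hd0 z) (hc0 z)) hz
          rw [← h0, mul_zero] at h1
          exact this.trans h1
        have h4 := (Finset.mem_filter.1 hz).2
        rw [← h0, mul_zero] at h4
        nlinarith [hd0 z]
      rw [h2]; simp
    · have h2 : ∑ z ∈ Hi, d z * ((1 + 1 / (r : ℝ)) * T) ≤ ∑ z ∈ Hi, d z * c z :=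
        Finset.sum_le_sum fun z hz =>
          mul_le_mul_of_nonneg_left (Finset.mem_filter.1 hz).2.le (hd0 z)
      rw [← Finset.sum_mul] at h2
      have h3 : ((1 + 1 / (r : ℝ)) * ∑ z ∈ Hi, d z) * T ≤ q * T := by
        calc _ = (∑ z ∈ Hi, d z) * ((1 + 1 / (r : ℝ)) * T) := by ring
          _ ≤ _ := h2.trans h1
      exact le_of_mul_le_mul_right h3 h0
  have hHi2 : ∑ z ∈ Hi, d z ≤ q - q / (2 * r) := by
    have h1 : (1 + 1 / (r : ℝ)) * (q - q / (2 * r)) ≥ q := by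
      have : (1 + 1 / (r : ℝ)) * (q - q / (2 * r)) = q + q * (r - 1) / (2 * r ^ 2) := by
        field_simp; ring
      rw [this]
      have : 0 ≤ (q : ℝ) * (r - 1) / (2 * r ^ 2) := by
        have : (0 : ℝ) ≤ r - 1 := by linarith
        positivity
      linarith
    exact le_of_mul_le_mul_left (hHis.trans h1) (by positivity)
  have : (q : ℝ) / (2 * r) = q / (4 * r) + q / (4 * r) := by field_simp; ring
  linarith

end Weights

/-! ### Covering independent sets by few containers -/

/-- The sets of `F` are covered by at most `N` containers of size at most `c`. -/
def CoveredBy {V : Type*} (F : Set (Finset V)) (c N : ℕ) : Prop :=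
  ∃ 𝒞 : Finset (Finset V), 𝒞.card ≤ N ∧ (∀ C ∈ 𝒞, C.card ≤ c) ∧ ∀ Y ∈ F, ∃ C ∈ 𝒞, Y ⊆ C

/-- The sets `Y` with `S ⊆ Y ⊆ Z` that meet every edge in fewer than `r` points. -/
def freeSets {V ι : Type*} [DecidableEq V] (e : ι → Finset V) (r : ℕ) (S Z : Finset V) :
    Set (Finset V) :=
  {Y | S ⊆ Y ∧ Y ⊆ Z ∧ ∀ i, (e i ∩ Y).card < r}

section Cover

variable {V ι : Type*} [Fintype V] [DecidableEq V]

theorem CoveredBy.mono {F F' : Set (Finset V)} {c c' N N' : ℕ} (h : CoveredBy F c N)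
    (hF : F' ⊆ F) (hc : c ≤ c') (hN : N ≤ N') : CoveredBy F' c' N' := by
  obtain ⟨𝒞, h1, h2, h3⟩ := h
  exact ⟨𝒞, h1.trans hN, fun C hC => (h2 C hC).trans hc, fun Y hY => h3 Y (hF hY)⟩

theorem coveredBy_of_subset {F : Set (Finset V)} {c : ℕ} {C : Finset V} (hC : C.card ≤ c)
    (hF : ∀ Y ∈ F, Y ⊆ C) : CoveredBy F c 1 :=
  ⟨{C}, by simp, by simpa using hC, fun Y hY => ⟨C, by simp, hF Y hY⟩⟩

theorem coveredBy_biUnion {α : Type*} {F : Set (Finset V)} {c N : ℕ} (G : Finset α)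
    (Fs : α → Set (Finset V)) (h : ∀ y ∈ G, CoveredBy (Fs y) c N)
    (hF : ∀ Y ∈ F, ∃ y ∈ G, Y ∈ Fs y) : CoveredBy F c (G.card * N) := by
  classical
  choose! 𝒞 h1 h2 h3 using h
  refine ⟨G.biUnion 𝒞, Finset.card_biUnion_le_card_mul _ _ _ h1, ?_, ?_⟩
  · intro C hC
    obtain ⟨y, hy, hC⟩ := Finset.mem_biUnion.1 hC
    exact h2 y hy C hC
  · intro Y hY
    obtain ⟨y, hy, hYy⟩ := hF Y hY
    obtain ⟨C, hC, hYC⟩ := h3 y hy Y hYy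
    exact ⟨C, Finset.mem_biUnion.2 ⟨y, hy, hC⟩, hYC⟩

theorem CoveredBy.union {F F' : Set (Finset V)} {c N N' : ℕ} (h : CoveredBy F c N)
    (h' : CoveredBy F' c N') : CoveredBy (F ∪ F') c (N + N') := by
  classical
  obtain ⟨𝒞, h1, h2, h3⟩ := h
  obtain ⟨𝒞', h1', h2', h3'⟩ := h'
  refine ⟨𝒞 ∪ 𝒞', (Finset.card_union_le _ _).trans (Nat.add_le_add h1 h1'), ?_, ?_⟩
  · intro C hC
    rcases Finset.mem_union.1 hC with h | h
    · exact h2 C h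
    · exact h2' C h
  · rintro Y (hY | hY)
    · obtain ⟨C, hC, hYC⟩ := h3 Y hY
      exact ⟨C, Finset.mem_union_left _ hC, hYC⟩
    · obtain ⟨C, hC, hYC⟩ := h3' Y hY
      exact ⟨C, Finset.mem_union_right _ hC, hYC⟩

/-- Bounds the container of the sets that avoid `G` outside `S`: at most `t` points of `G` escape
removal. -/
theorem card_sdiff_sdiff_le {S Z G : Finset V} {c t : ℕ} {g : ℝ} (hG : G ⊆ Z)
    (hg : g ≤ G.card) (hS : S.card ≤ t) (hc : (Z.card : ℝ) + t ≤ c + g) :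
    (Z \ (G \ S)).card ≤ c := by
  have h1 : (Z \ (G \ S)).card + (G \ S).card = Z.card :=
    Finset.card_sdiff_add_card_eq_card (Finset.sdiff_subset.trans hG)
  have h2 : G.card ≤ (G \ S).card + S.card := by
    have := Finset.le_card_sdiff S G
    omega
  have h3 : (Z.card : ℝ) + t ≤ c + G.card := by linarith
  have h4 : Z.card + t ≤ c + G.card := by exact_mod_cast h3
  omega

variable [Fintype ι] {e : ι → Finset V}

theorem goodSet_subset {w : ι → ℝ} {q r : ℕ} {Z : Finset V} {f : V → ℝ} (hq : 0 < q) (hr : 0 < r)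
    (heZ : ∀ i, e i ⊆ Z) : goodSet e w q r f ⊆ Z := by
  intro z hz
  have h := (Finset.mem_filter.1 hz).2.1
  have hV : (0 : ℝ) < Fintype.card V := by exact_mod_cast Fintype.card_pos_iff.2 ⟨z⟩
  have hq' : (0 : ℝ) < q := by exact_mod_cast hq
  have hr' : (0 : ℝ) < r := by exact_mod_cast hr
  by_contra hzZ
  have h0 : wdeg e w z = 0 := by
    refine Finset.sum_eq_zero fun i _ => ?_
    rw [if_neg fun hi => hzZ (heZ i hi)]
  rw [h0] at h
  have : 0 < (q : ℝ) / (4 * r * Fintype.card V) := by positivity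
  linarith

/-- The average of the links at the points of `T`. -/
noncomputable def avgLink (e : ι → Finset V) (w : ι → ℝ) (T : Finset V) (i : ι) : ℝ :=
  (∑ y ∈ T, linkWeight e w y i) / T.card

theorem wdeg_avgLink {w : ι → ℝ} (T : Finset V) (u : V) :
    wdeg e (avgLink e w T) u = (∑ y ∈ T, wdeg e (linkWeight e w y) u) / T.card := by
  unfold wdeg avgLink
  rw [Finset.sum_comm, Finset.sum_div]
  refine Finset.sum_congr rfl fun i _ => ?_
  split_ifs <;> simp

theorem sum_avgLink {w : ι → ℝ} {T : Finset V} (hT : T.Nonempty)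
    (hd : ∀ y ∈ T, wdeg e w y ≠ 0) : ∑ i, avgLink e w T i = 1 := by
  unfold avgLink
  rw [← Finset.sum_div, Finset.sum_comm, Finset.sum_congr rfl fun y hy => sum_linkWeight (hd y hy)]
  have : (T.card : ℝ) ≠ 0 := by exact_mod_cast hT.card_pos.ne'
  simp [this]

/-- Only links at points of `e i ∩ T` charge the edge `i`. There are at most `r` of them, so
averaging gains a factor `r / |T|`. -/
theorem avgLink_le {w : ι → ℝ} {M δ : ℝ} {r : ℕ} {T : Finset V}
    (hM : ∀ i, w i ≤ M) (hM0 : 0 ≤ M) (hδ : 0 < δ) (hd : ∀ y ∈ T, δ ≤ wdeg e w y) (i : ι)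
    (hr : (e i ∩ T).card ≤ r) : avgLink e w T i ≤ r * (M / δ) / T.card := by
  unfold avgLink
  refine div_le_div_of_nonneg_right ?_ (by positivity)
  have h1 : ∑ y ∈ T, linkWeight e w y i = ∑ y ∈ e i ∩ T, w i / wdeg e w y := by
    unfold linkWeight
    rw [← Finset.sum_filter, Finset.filter_mem_eq_inter, Finset.inter_comm]
  rw [h1]
  calc ∑ y ∈ e i ∩ T, w i / wdeg e w y ≤ ∑ y ∈ e i ∩ T, M / δ :=
        Finset.sum_le_sum fun y hy =>
          div_le_div₀ hM0 (hM i) hδ (hd y (Finset.mem_inter.1 hy).2)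
    _ = (e i ∩ T).card * (M / δ) := by simp
    _ ≤ r * (M / δ) := by gcongr

theorem pos_of_avgLink_pos {w : ι → ℝ} (hw : ∀ i, 0 ≤ w i) {T : Finset V} {i : ι}
    (h : 0 < avgLink e w T i) : 0 < w i ∧ ∃ y ∈ T, y ∈ e i := by
  have h1 : (∑ y ∈ T, linkWeight e w y i) ≠ 0 := by
    intro h0
    rw [avgLink, h0, zero_div] at h
    exact lt_irrefl _ h
  obtain ⟨y, hy, hne⟩ := Finset.exists_ne_zero_of_sum_ne_zero h1
  unfold linkWeight at hne
  split_ifs at hne with hyi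
  · refine ⟨lt_of_le_of_ne (hw i) ?_, y, hy, hyi⟩
    rintro h0
    rw [← h0, zero_div] at hne
    exact hne rfl
  · exact absurd rfl hne

/-- Adding the link of a good point to a sum of links increases its norm by little more than `a`. -/
theorem sum_sq_add_linkWeight_le {w : ι → ℝ} {q r : ℕ} {M a b c : ℝ} {f : V → ℝ} {y : V}
    (hr : 0 < r) (hq0 : 0 < q) (hq : ∀ i, (e i).card = q) (hw : ∀ i, 0 ≤ w i) (hM : ∀ i, w i ≤ M)
    (hM0 : 0 ≤ M)
    (hlin : ∀ i j u v, u ≠ v → u ∈ e i → v ∈ e i → u ∈ e j → v ∈ e j → i = j) (ha : 0 ≤ a)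
    (hwa : ∑ u, wdeg e w u ^ 2 ≤ a ^ 2) (hb : 0 ≤ b) (hfb : ∑ u, f u ^ 2 ≤ b ^ 2)
    (hy : y ∈ goodSet e w q r f) (hbc : 1 + 4 * r * Fintype.card V * M ≤ 2 * (c - (1 + 1 / (r : ℝ)) * a) * b) :
    ∑ u, (f u + wdeg e (linkWeight e w y) u) ^ 2 ≤ (b + c) ^ 2 := by
  obtain ⟨hy1, hy2⟩ := (Finset.mem_filter.1 hy).2
  have hn : (0 : ℝ) < Fintype.card V := by exact_mod_cast Fintype.card_pos_iff.2 ⟨y⟩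
  have hq' : (0 : ℝ) < q := by exact_mod_cast hq0
  have hr' : (0 : ℝ) < r := by exact_mod_cast hr
  have hδ : 0 < (q : ℝ) / (4 * r * Fintype.card V) := by positivity
  have hd : 0 < wdeg e w y := hδ.trans_le hy1
  have h1 := sum_sq_wdeg_linkWeight_le hq hw hM hM0 hlin hd.ne'
  have h2 : q * (M / wdeg e w y) ≤ 4 * r * Fintype.card V * M := by
    calc q * (M / wdeg e w y) ≤ q * (M / ((q : ℝ) / (4 * r * Fintype.card V))) := by gcongr
      _ = _ := by field_simp
  -- Cauchy–Schwarz; goodness of `y` transfers this bound, up to `1 + 1/r`, to the correlation of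
  -- `f` with the link.
  have h3 : ∑ u, f u * wdeg e w u ≤ b * a := by
    refine (abs_le_of_sq_le_sq' ?_ (by positivity)).2
    calc (∑ u, f u * wdeg e w u) ^ 2 ≤ (∑ u, f u ^ 2) * ∑ u, wdeg e w u ^ 2 :=
          Finset.sum_mul_sq_le_sq_mul_sq _ _ _
      _ ≤ b ^ 2 * a ^ 2 := by
          gcongr
      _ = _ := by ring
  have h4 : ∑ u, (f u + wdeg e (linkWeight e w y) u) ^ 2 = ∑ u, f u ^ 2 +
      2 * ∑ u, f u * wdeg e (linkWeight e w y) u + ∑ u, wdeg e (linkWeight e w y) u ^ 2 := by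
    rw [Finset.mul_sum, ← Finset.sum_add_distrib, ← Finset.sum_add_distrib]
    exact Finset.sum_congr rfl fun u _ => by ring
  have h5 : (1 + 1 / (r : ℝ)) * ∑ u, f u * wdeg e w u ≤ (1 + 1 / (r : ℝ)) * (b * a) := by gcongr
  rw [h4]
  nlinarith [sq_nonneg c]

end Cover

/-! ### The branching procedure that builds containers -/

section Phase

variable {V ι : Type*} [Fintype V] [DecidableEq V] [Fintype ι] {e : ι → Finset V}

theorem freeSets_insert_or {r : ℕ} {S Z G : Finset V} {Y : Finset V} (hY : Y ∈ freeSets e r S Z) :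
    Y ⊆ Z \ (G \ S) ∨ ∃ y ∈ G \ S, Y ∈ freeSets e r (insert y S) Z := by
  by_cases h : ∃ y ∈ G \ S, y ∈ Y
  · obtain ⟨y, hy, hyY⟩ := h
    exact Or.inr ⟨y, hy, Finset.insert_subset hyY hY.1, hY.2⟩
  · push Not at h
    exact Or.inl fun z hz => Finset.mem_sdiff.2 ⟨hY.2.1 hz, fun hzG => h z hzG hz⟩

/-- Greedy selection of `s` further points: from weights on edges with `j` points in `S` to weights
on edges with `j + 1` points in a slightly larger set, with almost the same second moment. -/
theorem coveredBy_of_coveredBy_next {w : ι → ℝ} {q r s j N c : ℕ} {M a : ℝ} {S Z : Finset V}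
    (hr : 0 < r) (hq0 : 0 < q) (hs : 0 < s) (hq : ∀ i, (e i).card = q)
    (hlin : ∀ i j u v, u ≠ v → u ∈ e i → v ∈ e i → u ∈ e j → v ∈ e j → i = j)
    (heZ : ∀ i, e i ⊆ Z) (hw : ∀ i, 0 ≤ w i) (hw1 : ∑ i, w i = 1) (hM : ∀ i, w i ≤ M)
    (hM0 : 0 ≤ M) (ha : 0 < a) (hwa : ∑ u, wdeg e w u ^ 2 ≤ a ^ 2)
    (hS : ∀ i, 0 < w i → j ≤ (e i ∩ S).card)
    (hwidth : 1 + 4 * r * Fintype.card V * M ≤ 2 * s * a ^ 2 / r ^ 2)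
    (hc : (Z.card : ℝ) + (S.card + s : ℕ) ≤ c + (q / (4 * r)) ^ 2 / a ^ 2) (hN : 1 ≤ N)
    (next : ∀ (w' : ι → ℝ) (S' : Finset V), S'.card ≤ S.card + s → (∀ i, 0 ≤ w' i) →
      ∑ i, w' i = 1 → (∀ i, w' i ≤ M * (4 * r ^ 2 * Fintype.card V / (s * q))) →
      ∑ u, wdeg e w' u ^ 2 ≤ ((1 + 4 / r) * a) ^ 2 →
      (∀ i, 0 < w' i → j + 1 ≤ (e i ∩ S').card) → CoveredBy (freeSets e r S' Z) c N) :
    CoveredBy (freeSets e r S Z) c ((Fintype.card V + 1) ^ s * N) := by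
  classical
  have hr' : (0 : ℝ) < r := by exact_mod_cast hr
  have hr1 : (1 : ℝ) ≤ r := by exact_mod_cast hr
  have hs' : (0 : ℝ) < s := by exact_mod_cast hs
  have hq' : (0 : ℝ) < q := by exact_mod_cast hq0
  set n := Fintype.card V with hn
  -- The norm budget starts at `b` rather than `0`: with this slack `hwidth` absorbs the second
  -- moment of each link, and every new point costs only `d`. Finally `(b + s * d) / s = (1/r + (1 +
  -- 1/r)²) a ≤ (1 + 4/r) a`.
  set b : ℝ := s * a / r with hb
  set d : ℝ := (1 + 1 / (r : ℝ)) ^ 2 * a with hd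
  have hb0 : 0 < b := by positivity
  have hd0 : 0 < d := by positivity
  suffices H : ∀ t : ℕ, ∀ T : Finset V, t + T.card = s → Disjoint T S →
      (∀ y ∈ T, (q : ℝ) / (4 * r * n) ≤ wdeg e w y) →
      ∑ u, (∑ y ∈ T, wdeg e (linkWeight e w y) u) ^ 2 ≤ (b + T.card * d) ^ 2 →
      CoveredBy (freeSets e r (S ∪ T) Z) c ((n + 1) ^ t * N) by
    have := H s ∅ (by simp) (by simp) (by simp) (by simp; positivity)
    simpa using this
  intro t
  induction t with
  | zero =>
    intro T hT hTS hdeg hnorm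
    rw [zero_add] at hT
    rw [pow_zero, one_mul]
    -- An edge with `r` points in `S ∪ T` leaves no free set to cover.
    by_cases hfree : ∃ i, r ≤ (e i ∩ (S ∪ T)).card
    · obtain ⟨i, hi⟩ := hfree
      refine ⟨∅, by simp, by simp, fun Y hY => ?_⟩
      have h1 := Finset.card_le_card (Finset.inter_subset_inter (le_refl (e i)) hY.1)
      have h2 := hY.2.2 i
      omega
    push Not at hfree
    have hTne : T.Nonempty := Finset.card_pos.1 (by omega)
    have hnpos : (0 : ℝ) < n := by
      obtain ⟨y, _⟩ := hTne
      exact_mod_cast Fintype.card_pos_iff.2 ⟨y⟩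
    have hδ : 0 < (q : ℝ) / (4 * r * n) := by positivity
    have hTs : (T.card : ℝ) = s := by exact_mod_cast hT
    refine next (avgLink e w T) (S ∪ T) ?_ ?_ ?_ ?_ ?_ ?_
    · exact (Finset.card_union_le _ _).trans (by omega)
    · intro i
      exact div_nonneg (Finset.sum_nonneg fun y _ => linkWeight_nonneg hw y i) (by positivity)
    · exact sum_avgLink hTne fun y hy => (hδ.trans_le (hdeg y hy)).ne'
    · intro i
      have h1 : (e i ∩ T).card ≤ r :=
        (Finset.card_le_card (Finset.inter_subset_inter_left Finset.subset_union_right)).trans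
          (hfree i).le
      refine (avgLink_le hM hM0 hδ hdeg i h1).trans (le_of_eq ?_)
      rw [hTs]
      field_simp
    · have h1 : ∀ u, wdeg e (avgLink e w T) u ^ 2 =
          (∑ y ∈ T, wdeg e (linkWeight e w y) u) ^ 2 / s ^ 2 := by
        intro u
        rw [wdeg_avgLink, hTs, div_pow]
      simp_rw [h1]
      rw [← Finset.sum_div, div_le_iff₀ (by positivity), ← mul_pow]
      refine hnorm.trans (pow_le_pow_left₀ (by positivity) ?_ 2)
      rw [hTs, hb, hd]
      have h2 : s * a / r + s * ((1 + 1 / (r : ℝ)) ^ 2 * a) =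
          s * a * (1 + 3 / r + 1 / r * (1 / r)) := by field_simp; ring
      have h3 : (1 : ℝ) / r * (1 / r) ≤ 1 / r := by
        have : (1 : ℝ) / r ≤ 1 := by rw [div_le_one hr']; exact hr1
        exact mul_le_of_le_one_right (by positivity) this
      have h4 : (4 : ℝ) / r = 3 / r + 1 / r := by ring
      rw [h2]
      calc s * a * (1 + 3 / r + 1 / r * (1 / r)) ≤ s * a * (1 + 4 / r) :=
            mul_le_mul_of_nonneg_left (by linarith) (by positivity)
        _ = _ := by ring
    · intro i hi
      obtain ⟨hwi, y, hyT, hyi⟩ := pos_of_avgLink_pos hw hi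
      have h1 := hS i hwi
      have hyS : y ∉ S := Finset.disjoint_left.1 hTS hyT
      have h2 : insert y (e i ∩ S) ⊆ e i ∩ (S ∪ T) := by
        refine Finset.insert_subset ?_ (Finset.inter_subset_inter_left Finset.subset_union_left)
        simp [hyi, hyT]
      have h3 := Finset.card_le_card h2
      rw [Finset.card_insert_of_notMem (by simp [hyS])] at h3
      omega
  | succ t ih =>
    intro T hT hTS hdeg hnorm
    set f : V → ℝ := fun u => ∑ y ∈ T, wdeg e (linkWeight e w y) u with hf
    have hf0 : ∀ u, 0 ≤ f u := fun u =>
      Finset.sum_nonneg fun y _ => wdeg_nonneg (linkWeight_nonneg hw y) u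
    set G := goodSet e w q r f with hG
    have hmass := le_sum_goodSet hr hq hw hw1 hf0
    have hcardG := sq_le_card_mul_of_le_sum hwa (by positivity) hmass
    have hC : (Z \ (G \ (S ∪ T))).card ≤ c := by
      refine card_sdiff_sdiff_le (t := S.card + s) (goodSet_subset hq0 hr heZ) ?_ ?_ hc
      · rw [div_le_iff₀ (by positivity)]
        exact hcardG
      · exact (Finset.card_union_le _ _).trans (by omega)
    have hstep : ∀ y ∈ G \ (S ∪ T),
        CoveredBy (freeSets e r (insert y (S ∪ T)) Z) c ((n + 1) ^ t * N) := by
      intro y hy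
      obtain ⟨hyG, hyST⟩ := Finset.mem_sdiff.1 hy
      have hyT : y ∉ T := fun h => hyST (Finset.mem_union_right _ h)
      have hyS : y ∉ S := fun h => hyST (Finset.mem_union_left _ h)
      have := ih (insert y T) (by rw [Finset.card_insert_of_notMem hyT]; omega)
        (Finset.disjoint_insert_left.2 ⟨hyS, hTS⟩)
        (by
          intro z hz
          rcases Finset.mem_insert.1 hz with rfl | hz
          · exact (Finset.mem_filter.1 hyG).2.1
          · exact hdeg z hz)
        (by
          have h1 := sum_sq_add_linkWeight_le (b := b + T.card * d) (c := d) hr hq0 hq hw hM hM0 hlin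
            ha.le hwa (by positivity) hnorm hyG
            (by
              have h2 : 2 * (d - (1 + 1 / (r : ℝ)) * a) * b = 2 * s * a ^ 2 / r ^ 2 * (1 + 1 / r) := by
                rw [hd, hb]; field_simp; ring
              have h3 : 2 * (d - (1 + 1 / (r : ℝ)) * a) * b ≤
                  2 * (d - (1 + 1 / (r : ℝ)) * a) * (b + T.card * d) := by
                have h4 : d - (1 + 1 / (r : ℝ)) * a = (1 / r) * (1 + 1 / r) * a := by
                  rw [hd]; ring
                rw [h4]
                gcongr
                have : 0 ≤ (T.card : ℝ) * d := by positivity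
                linarith
              have h5 : 2 * s * a ^ 2 / r ^ 2 ≤ 2 * s * a ^ 2 / r ^ 2 * (1 + 1 / (r : ℝ)) := by
                refine le_mul_of_one_le_right (by positivity) ?_
                have : (0 : ℝ) ≤ 1 / r := by positivity
                linarith
              linarith)
          rw [Finset.card_insert_of_notMem hyT]
          convert h1 using 1
          · refine Finset.sum_congr rfl fun u _ => ?_
            rw [Finset.sum_insert hyT, add_comm]
          · push_cast; ring)
      rwa [Finset.union_insert] at this
    -- One container for the sets missing `G` outside `S ∪ T`, and one branch for each possible new
    -- point: a factor of at most `n + 1`.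
    have h1 := coveredBy_biUnion (F := {Y | ∃ y ∈ G \ (S ∪ T),
      Y ∈ freeSets e r (insert y (S ∪ T)) Z}) (G \ (S ∪ T)) _ hstep (fun Y hY => hY)
    have h2 := coveredBy_of_subset (F := {Y | Y ⊆ Z \ (G \ (S ∪ T))}) hC fun Y hY => hY
    refine (h2.union h1).mono ?_ le_rfl ?_
    · intro Y hY
      exact freeSets_insert_or hY
    · have h3 : (G \ (S ∪ T)).card ≤ n := Finset.card_le_univ _
      have h4 : 1 ≤ (n + 1) ^ t * N := Nat.one_le_iff_ne_zero.2 (by positivity)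
      calc 1 + (G \ (S ∪ T)).card * ((n + 1) ^ t * N)
          ≤ (n + 1) ^ t * N + n * ((n + 1) ^ t * N) := by gcongr
        _ = _ := by ring

/-- If all edges in the support of `w` have `r - 1` points in `S`, the other points of a free set
avoid those edges. -/
theorem coveredBy_of_almost_full {w : ι → ℝ} {q r c : ℕ} {a : ℝ} {S Z : Finset V}
    (hr : 0 < r) (hq : ∀ i, (e i).card = q)
    (heZ : ∀ i, e i ⊆ Z) (hw : ∀ i, 0 ≤ w i) (hw1 : ∑ i, w i = 1) (ha : 0 < a)
    (hwa : ∑ u, wdeg e w u ^ 2 ≤ a ^ 2) (hS : ∀ i, 0 < w i → r - 1 ≤ (e i ∩ S).card)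
    (hc : (Z.card : ℝ) + S.card ≤ c + (q / (4 * r)) ^ 2 / a ^ 2) :
    CoveredBy (freeSets e r S Z) c 1 := by
  classical
  have hr' : (1 : ℝ) ≤ r := by exact_mod_cast hr
  set G : Finset V := {u | 0 < wdeg e w u} with hG
  have hedge : ∀ u ∈ G, ∃ i, u ∈ e i ∧ 0 < w i := by
    intro u hu
    obtain ⟨i, _, hi⟩ := Finset.exists_ne_zero_of_sum_ne_zero (Finset.mem_filter.1 hu).2.ne'
    split_ifs at hi with h
    · exact ⟨i, h, lt_of_le_of_ne (hw i) (Ne.symm hi)⟩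
    · exact absurd rfl hi
  have hmass : (q : ℝ) / (4 * r) ≤ ∑ u ∈ G, wdeg e w u := by
    have h1 : ∑ u ∈ G, wdeg e w u = q := by
      have h2 := sum_wdeg (w := w) hq
      rw [hw1, mul_one] at h2
      rw [← h2]
      refine Finset.sum_subset (Finset.subset_univ _) fun u _ hu => ?_
      have : ¬ 0 < wdeg e w u := fun h => hu (Finset.mem_filter.2 ⟨Finset.mem_univ _, h⟩)
      exact le_antisymm (not_lt.1 this) (wdeg_nonneg hw u)
    rw [h1]
    exact div_le_self (by positivity) (by linarith)
  refine coveredBy_of_subset (C := Z \ (G \ S)) ?_ ?_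
  · refine card_sdiff_sdiff_le (t := S.card) ?_ ?_ le_rfl hc
    · intro u hu
      obtain ⟨i, hui, _⟩ := hedge u hu
      exact heZ i hui
    · rw [div_le_iff₀ (by positivity)]
      exact sq_le_card_mul_of_le_sum hwa (by positivity) hmass
  · intro Y hY
    rcases freeSets_insert_or (G := G) hY with h | ⟨y, hy, hyY⟩
    · exact h
    · exfalso
      obtain ⟨hyG, hyS⟩ := Finset.mem_sdiff.1 hy
      obtain ⟨i, hyi, hwi⟩ := hedge y hyG
      have h1 := hS i hwi
      have h2 : insert y (e i ∩ S) ⊆ e i ∩ Y := by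
        refine Finset.insert_subset ?_ (Finset.inter_subset_inter_left hY.1)
        exact Finset.mem_inter.2 ⟨hyi, hyY.1 (Finset.mem_insert_self _ _)⟩
      have h3 := Finset.card_le_card h2
      rw [Finset.card_insert_of_notMem (by simp [hyS])] at h3
      have h4 := hY.2.2 i
      omega

/-- Free sets of a linear hypergraph with well-distributed degrees have few containers that are
smaller than `Z`. -/
theorem coveredBy_freeSets {q r s c : ℕ} {M a : ℝ} {Z : Finset V} {w : ι → ℝ}
    (hr : 0 < r) (hq0 : 0 < q) (hs : 0 < s) (hq : ∀ i, (e i).card = q)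
    (hlin : ∀ i j u v, u ≠ v → u ∈ e i → v ∈ e i → u ∈ e j → v ∈ e j → i = j)
    (heZ : ∀ i, e i ⊆ Z) (hw : ∀ i, 0 ≤ w i) (hw1 : ∑ i, w i = 1) (hM : ∀ i, w i ≤ M)
    (hM0 : 0 ≤ M) (ha : 0 < a) (hwa : ∑ u, wdeg e w u ^ 2 ≤ a ^ 2)
    (hwidth : ∀ j, j + 1 < r → 1 + 4 * r * Fintype.card V *
      (M * (4 * r ^ 2 * Fintype.card V / (s * q)) ^ j) ≤ 2 * s * a ^ 2 / r ^ 2)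
    (hc : (Z.card : ℝ) + (r * s : ℕ) ≤ c + (q / (4 * r)) ^ 2 / ((1 + 4 / r) ^ r * a) ^ 2) :
    CoveredBy (freeSets e r ∅ Z) c ((Fintype.card V + 1) ^ (r * s)) := by
  set n := Fintype.card V with hn
  set K : ℝ := 4 * r ^ 2 * n / (s * q) with hK
  have hr' : (0 : ℝ) < r := by exact_mod_cast hr
  have hlam : (1 : ℝ) ≤ 1 + 4 / r := by
    have : (0 : ℝ) ≤ 4 / r := by positivity
    linarith
  have hmono : ∀ j ≤ r, (q / (4 * r) : ℝ) ^ 2 / ((1 + 4 / r) ^ r * a) ^ 2 ≤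
      (q / (4 * r)) ^ 2 / ((1 + 4 / r) ^ j * a) ^ 2 := by
    intro j hj
    gcongr
  -- `j` phases are done and `t` remain before the almost full case. Each multiplies the bound on
  -- edge weights by `K` and the norm bound by `1 + 4/r`.
  suffices H : ∀ t j : ℕ, t + j + 1 = r → ∀ (w : ι → ℝ) (S : Finset V), S.card ≤ j * s →
      (∀ i, 0 ≤ w i) → ∑ i, w i = 1 → (∀ i, w i ≤ M * K ^ j) →
      ∑ u, wdeg e w u ^ 2 ≤ ((1 + 4 / r) ^ j * a) ^ 2 →
      (∀ i, 0 < w i → j ≤ (e i ∩ S).card) →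
      CoveredBy (freeSets e r S Z) c ((n + 1) ^ (t * s)) by
    refine (H (r - 1) 0 (by omega) w ∅ (by simp) hw hw1 (by simpa using hM) (by simpa using hwa)
      (by simp)).mono le_rfl le_rfl ?_
    exact Nat.pow_le_pow_right (by omega) (Nat.mul_le_mul_right _ (by omega))
  intro t
  induction t with
  | zero =>
    intro j hj w S hS hw hw1 hM hwa hjS
    rw [zero_mul, pow_zero]
    refine coveredBy_of_almost_full hr hq heZ hw hw1 (a := (1 + 4 / r) ^ j * a) (by positivity) hwa
      (fun i hi => (by omega : r - 1 ≤ j).trans (hjS i hi)) ?_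
    have h1 := hmono j (by omega)
    have h2 : (S.card : ℝ) ≤ (r * s : ℕ) := by
      exact_mod_cast hS.trans (Nat.mul_le_mul_right _ (by omega))
    linarith
  | succ t ih =>
    intro j hj w S hS hw hw1 hM hwa hjS
    have h1 := hmono j (by omega)
    have h2 : ((S.card + s : ℕ) : ℝ) ≤ (r * s : ℕ) := by
      have : S.card + s ≤ (j + 1) * s := by rw [add_mul, one_mul]; omega
      exact_mod_cast this.trans (Nat.mul_le_mul_right _ (by omega))
    have := coveredBy_of_coveredBy_next (w := w) (j := j) (N := (n + 1) ^ (t * s)) (c := c)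
      (M := M * K ^ j) (a := (1 + 4 / r) ^ j * a) (S := S) hr hq0 hs hq hlin heZ hw hw1 hM
      (by positivity) (by positivity) hwa hjS
      (by
        refine (hwidth j (by omega)).trans ?_
        gcongr
        exact le_mul_of_one_le_left ha.le (one_le_pow₀ hlam))
      (by linarith) (Nat.one_le_pow _ _ (by omega))
      (by
        intro w' S' hS' hw' hw1' hM' hwa' hj'
        refine ih (j + 1) (by omega) w' S' ?_ hw' hw1' ?_ ?_ hj'
        · rw [add_mul, one_mul]; omega
        · intro i
          have hKj : M * K ^ (j + 1) = M * K ^ j * K := by ring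
          exact (hM' i).trans hKj.ge
        · convert hwa' using 2
          ring)
    rw [← pow_add] at this
    convert this using 2
    ring

end Phase

/-! ### Lines in a grid -/

/-- The points of the grid `{0, …, k - 1} × {0, …, H - 1}` on the line `y = a x + b`. -/
def gridLine {A k H : ℕ} (i : Fin A × Fin H) : Finset (Fin k × Fin H) :=
  {z | (z.2 : ℕ) = i.1 * z.1 + i.2}

section Grid

variable {A k H : ℕ}

theorem mem_gridLine {i : Fin A × Fin H} {z : Fin k × Fin H} :
    z ∈ gridLine i ↔ (z.2 : ℕ) = i.1 * z.1 + i.2 := by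
  simp [gridLine]

theorem card_gridLine_le (i : Fin A × Fin H) : (gridLine (k := k) i).card ≤ k := by
  have : (gridLine (k := k) i).card ≤ (Finset.univ : Finset (Fin k)).card := by
    refine Finset.card_le_card_of_injOn Prod.fst (fun _ _ => Finset.mem_univ _) ?_
    intro z hz z' hz' h
    have h1 := mem_gridLine.1 hz
    have h2 := mem_gridLine.1 hz'
    rw [← h] at h2
    exact Prod.ext h (Fin.ext (h1.trans h2.symm))
  simpa using this

theorem gridLine_linear (i j : Fin A × Fin H) (u v : Fin k × Fin H) (huv : u ≠ v)
    (hui : u ∈ gridLine i) (hvi : v ∈ gridLine i) (huj : u ∈ gridLine j) (hvj : v ∈ gridLine j) :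
    i = j := by
  rw [mem_gridLine] at *
  have hx : (u.1 : ℕ) ≠ v.1 := by
    intro h
    rw [h] at hui
    exact huv (Prod.ext (Fin.ext h) (Fin.ext (hui.trans hvi.symm)))
  have ha : (i.1 : ℕ) = j.1 := by
    have h1 : ((i.1 : ℕ) : ℤ) * u.1 + i.2 = j.1 * u.1 + j.2 := by exact_mod_cast hui.symm.trans huj
    have h2 : ((i.1 : ℕ) : ℤ) * v.1 + i.2 = j.1 * v.1 + j.2 := by exact_mod_cast hvi.symm.trans hvj
    have h3 : (((i.1 : ℕ) : ℤ) - j.1) * ((u.1 : ℕ) - (v.1 : ℕ)) = 0 := by linarith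
    rcases mul_eq_zero.1 h3 with h | h
    · omega
    · omega
  refine Prod.ext (Fin.ext ha) (Fin.ext ?_)
  rw [ha] at hui
  omega

theorem card_lines_through_le (z : Fin k × Fin H) :
    (Finset.univ.filter fun i : Fin A × Fin H => z ∈ gridLine i).card ≤ A := by
  have : (Finset.univ.filter fun i : Fin A × Fin H => z ∈ gridLine i).card ≤
      (Finset.univ : Finset (Fin A)).card := by
    refine Finset.card_le_card_of_injOn Prod.fst (fun _ _ => Finset.mem_univ _) ?_
    intro i hi j hj h
    have h1 := mem_gridLine.1 (Finset.mem_filter.1 hi).2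
    have h2 := mem_gridLine.1 (Finset.mem_filter.1 hj).2
    rw [← h] at h2
    exact Prod.ext h (Fin.ext (by omega))
  simpa using this

theorem le_card_lines_through (z : Fin k × Fin H) (hz : A * k ≤ z.2) :
    A ≤ (Finset.univ.filter fun i : Fin A × Fin H => z ∈ gridLine i).card := by
  have hle : ∀ a : Fin A, (a : ℕ) * z.1 ≤ z.2 := fun a =>
    (Nat.mul_le_mul a.2.le z.1.2.le).trans hz
  have : (Finset.univ : Finset (Fin A)).card ≤
      (Finset.univ.filter fun i : Fin A × Fin H => z ∈ gridLine i).card := by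
    refine Finset.card_le_card_of_injOn
      (fun a => (a, ⟨z.2 - a * z.1, (Nat.sub_le _ _).trans_lt z.2.2⟩)) ?_ ?_
    · intro a _
      refine Finset.mem_coe.2 (Finset.mem_filter.2 ⟨Finset.mem_univ _, mem_gridLine.2 ?_⟩)
      have := hle a
      simp only
      omega
    · intro a _ b _ h
      exact (Prod.ext_iff.1 h).1
  simpa using this

theorem card_low_le (t : ℕ) :
    (Finset.univ.filter fun z : Fin k × Fin H => (z.2 : ℕ) < t).card ≤ k * t := by
  have : (Finset.univ.filter fun z : Fin k × Fin H => (z.2 : ℕ) < t).card ≤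
      ((Finset.univ : Finset (Fin k)) ×ˢ Finset.range t).card := by
    refine Finset.card_le_card_of_injOn (fun z => (z.1, (z.2 : ℕ))) ?_ ?_
    · intro z hz
      simpa using hz
    · intro z _ z' _ h
      have := Prod.ext_iff.1 h
      exact Prod.ext this.1 (Fin.ext this.2)
  simpa using this

/-- A dense subset of the grid has many points on many of the lines. -/
theorem card_rich_lines_ge {q : ℕ} (hk : k = 256 * q) (hq : 0 < q) (hH : H = 128 * A * k)
    (Z : Finset (Fin k × Fin H)) (hZ : k * H ≤ 64 * Z.card) :
    A * A * k ≤ 2 * (Finset.univ.filter fun i : Fin A × Fin H => q ≤ (gridLine i ∩ Z).card).card := by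
  classical
  set R := Finset.univ.filter fun i : Fin A × Fin H => q ≤ (gridLine i ∩ Z).card with hR
  set Z' := Z.filter fun z => A * k ≤ z.2 with hZ'
  have h1 : Z.card ≤ Z'.card + k * (A * k) := by
    rw [← Finset.card_filter_add_card_filter_not (s := Z) (fun z => A * k ≤ (z.2 : ℕ))]
    refine Nat.add_le_add_left (le_trans (Finset.card_le_card ?_) (card_low_le (A * k))) _
    intro z hz
    have := (Finset.mem_filter.1 hz).2
    exact Finset.mem_filter.2 ⟨Finset.mem_univ _, not_le.1 this⟩
  -- Double counting of incidences. The high points give at least `A²k²`; lines with fewer than `q`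
  -- points account for at most `A H q`, which is half of this, and each rich line for at most `k`.
  have h2 : A * Z'.card ≤ ∑ i : Fin A × Fin H, (gridLine i ∩ Z).card := by
    have h3 : ∑ i : Fin A × Fin H, (gridLine i ∩ Z).card =
        ∑ z ∈ Z, (Finset.univ.filter fun i : Fin A × Fin H => z ∈ gridLine i).card := by
      have : ∀ i : Fin A × Fin H, (gridLine i ∩ Z).card = (Z.filter fun z => z ∈ gridLine i).card := by
        intro i
        rw [Finset.filter_mem_eq_inter, Finset.inter_comm]
      simp_rw [this]
      exact Finset.sum_card_bipartiteAbove_eq_sum_card_bipartiteBelow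
        (s := (Finset.univ : Finset (Fin A × Fin H))) (t := Z) fun i z => z ∈ gridLine i
    rw [h3]
    calc A * Z'.card = ∑ z ∈ Z', A := by simp [mul_comm]
      _ ≤ ∑ z ∈ Z', (Finset.univ.filter fun i : Fin A × Fin H => z ∈ gridLine i).card :=
          Finset.sum_le_sum fun z hz => le_card_lines_through z (Finset.mem_filter.1 hz).2
      _ ≤ _ := Finset.sum_le_sum_of_subset (Finset.filter_subset _ _)
  have h4 : ∑ i : Fin A × Fin H, (gridLine i ∩ Z).card ≤ R.card * k + A * H * q := by
    have : ∀ i : Fin A × Fin H, (gridLine i ∩ Z).card ≤ (if i ∈ R then k else 0) + q := by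
      intro i
      split_ifs with h
      · exact ((Finset.card_le_card Finset.inter_subset_left).trans (card_gridLine_le i)).trans
          (Nat.le_add_right _ _)
      · have : ¬ q ≤ (gridLine i ∩ Z).card := fun h' =>
          h (Finset.mem_filter.2 ⟨Finset.mem_univ _, h'⟩)
        omega
    refine (Finset.sum_le_sum fun i _ => this i).trans (le_of_eq ?_)
    rw [Finset.sum_add_distrib, ← Finset.sum_filter]
    simp
  have h5 : 2 * (A * k * k) ≤ Z.card := by
    have hkH : k * H = 128 * (A * k * k) := by rw [hH]; ring
    omega
  have h6 : A * k * k ≤ Z'.card := by nlinarith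
  have h7 : A * (A * k * k) ≤ R.card * k + A * H * q :=
    ((Nat.mul_le_mul_left A h6).trans h2).trans h4
  have h8 : 2 * (A * H * q) = A * (A * k * k) := by rw [hH, hk]; ring
  have hkpos : 0 < k := by omega
  have h9 : A * A * k * k ≤ 2 * R.card * k := by nlinarith
  exact Nat.le_of_mul_le_mul_right h9 hkpos

/-! ### Containers for the grid -/

theorem one_add_div_pow_le {r : ℕ} (hr : 0 < r) : (1 + 4 / (r : ℝ)) ^ r ≤ 55 := by
  have hr' : (0 : ℝ) < r := by exact_mod_cast hr
  have h1 : 1 + 4 / (r : ℝ) ≤ Real.exp (4 / r) := by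
    have := Real.add_one_le_exp (4 / (r : ℝ)); linarith
  calc (1 + 4 / (r : ℝ)) ^ r ≤ Real.exp (4 / r) ^ r := by gcongr
    _ = Real.exp 1 ^ 4 := by
        rw [← Real.exp_nat_mul, ← Real.exp_nat_mul]; congr 1; field_simp; norm_num
    _ ≤ 2.7182818286 ^ 4 := by gcongr; exact Real.exp_one_lt_d9.le
    _ ≤ 55 := by norm_num

/-- A dense set `Z` of grid points has few containers, all smaller than `Z` by `D`, for its subsets
with fewer than `r` points on each line. -/
theorem coveredBy_freeSets_grid {q r D : ℕ} (hr : 2 ^ 40 ≤ r) (hq : r ^ 6 ≤ q)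
    (hA : A = r * (4 * q) ^ (r - 1)) (hk : k = 256 * q) (hH : H = 128 * A * k)
    (hD : D * r ^ 3 = k * H) (Z : Finset (Fin k × Fin H)) (hZ : k * H ≤ 64 * Z.card) :
    CoveredBy (freeSets (gridLine (A := A)) r ∅ Z) (Z.card - D)
      ((k * H + 1) ^ (r * (2 ^ 23 * r ^ 2 * A))) := by
  classical
  have hr0 : 0 < r := lt_of_lt_of_le (by norm_num) hr
  have hq0 : 0 < q := lt_of_lt_of_le (by positivity) hq
  have hA0 : 0 < A := by rw [hA]; positivity
  have hk0 : 0 < k := by omega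
  have hr' : (2 : ℝ) ^ 40 ≤ r := by exact_mod_cast hr
  have hrpos : (0 : ℝ) < r := by exact_mod_cast hr0
  have hqpos : (0 : ℝ) < q := by exact_mod_cast hq0
  have hApos : (0 : ℝ) < A := by exact_mod_cast hA0
  have hkR : (k : ℝ) = 256 * q := by exact_mod_cast hk
  have hHR : (H : ℝ) = 128 * A * (256 * q) := by rw [hH, hk]; push_cast; ring
  set ι := {i : Fin A × Fin H // q ≤ (gridLine i ∩ Z).card} with hι
  have hex : ∀ i : ι, ∃ t ⊆ gridLine i.1 ∩ Z, t.card = q := fun i =>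
    Finset.exists_subset_card_eq i.2
  choose e he1 he2 using hex
  have hιcard : A * A * k ≤ 2 * Fintype.card ι := by
    have := card_rich_lines_ge hk hq0 hH Z hZ
    rwa [← Fintype.card_subtype] at this
  have hιcardR : (A : ℝ) * A * (256 * q) ≤ 2 * Fintype.card ι := by
    rw [← hkR]; exact_mod_cast hιcard
  have hιpos : (0 : ℝ) < Fintype.card ι := by
    have : (0 : ℝ) < A * A * (256 * q) := by positivity
    linarith
  set w : ι → ℝ := fun _ => 1 / Fintype.card ι with hw
  have hw0 : ∀ i, 0 ≤ w i := fun i => by positivity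
  have hw1 : ∑ i, w i = 1 := by
    simp only [hw, Finset.sum_const, Finset.card_univ, nsmul_eq_mul]
    field_simp
  have hdeg : ∀ u, wdeg e w u ≤ 1 / (128 * A * q) := by
    intro u
    have h1 : wdeg e w u = (Finset.univ.filter fun i : ι => u ∈ e i).card * (1 / Fintype.card ι) := by
      unfold wdeg
      rw [← Finset.sum_filter, Finset.sum_const, nsmul_eq_mul]
    have h2 : (Finset.univ.filter fun i : ι => u ∈ e i).card ≤ A := by
      refine le_trans ?_ (card_lines_through_le (A := A) u)
      refine Finset.card_le_card_of_injOn Subtype.val ?_ Subtype.val_injective.injOn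
      intro i hi
      have := he1 i (Finset.mem_filter.1 hi).2
      exact Finset.mem_coe.2 (Finset.mem_filter.2 ⟨Finset.mem_univ _, (Finset.mem_inter.1 this).1⟩)
    rw [h1]
    calc _ ≤ (A : ℝ) * (1 / Fintype.card ι) := by gcongr
      _ ≤ (A : ℝ) * (1 / (A * A * (128 * q))) := by
          gcongr
          linarith
      _ = _ := by field_simp
  -- Degrees are at most `1 / (128 A q)` and sum to `q`, whence the second moment.
  set a : ℝ := Real.sqrt (1 / (128 * A)) with ha
  have ha2 : a ^ 2 = 1 / (128 * A) := Real.sq_sqrt (by positivity)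
  have ha0 : 0 < a := Real.sqrt_pos.2 (by positivity)
  have hwa : ∑ u, wdeg e w u ^ 2 ≤ a ^ 2 := by
    calc ∑ u, wdeg e w u ^ 2 ≤ ∑ u, wdeg e w u * (1 / (128 * A * q)) := by
          refine Finset.sum_le_sum fun u _ => ?_
          rw [sq]
          exact mul_le_mul_of_nonneg_left (hdeg u) (wdeg_nonneg hw0 u)
      _ = a ^ 2 := by
          rw [← Finset.sum_mul, sum_wdeg he2, hw1, ha2]
          field_simp
  have hcardV : Fintype.card (Fin k × Fin H) = k * H := by simp
  have hs0 : 0 < 2 ^ 23 * r ^ 2 * A := by positivity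
  have hmain := coveredBy_freeSets (e := e) (q := q) (r := r) (s := 2 ^ 23 * r ^ 2 * A)
    (c := Z.card - D) (M := 2 / (A * A * (256 * q))) (a := a) (Z := Z) (w := w) hr0 hq0 hs0 he2
    (by
      intro i j u v huv hui hvi huj hvj
      exact Subtype.ext (gridLine_linear i.1 j.1 u v huv
        (Finset.mem_inter.1 (he1 i hui)).1 (Finset.mem_inter.1 (he1 i hvi)).1
        (Finset.mem_inter.1 (he1 j huj)).1 (Finset.mem_inter.1 (he1 j hvj)).1))
    (fun i u hu => (Finset.mem_inter.1 (he1 i hu)).2) hw0 hw1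
    (by
      intro i
      simp only [hw]
      rw [div_le_div_iff₀ hιpos (by positivity)]
      linarith)
    (by positivity) ha0 hwa
    (by
      intro j hj
      rw [hcardV, ha2]
      push_cast
      rw [hkR, hHR]
      -- The choice of `s` makes the growth factor `4q` and the right-hand side `2 ^ 17`. The size
      -- of `A` keeps the left-hand side at most `1 + 2 ^ 16` in every phase.
      have hK : 4 * (r : ℝ) ^ 2 * (256 * q * (128 * A * (256 * q))) / (8388608 * r ^ 2 * A * q) =
          4 * q := by field_simp; norm_num
      rw [hK]
      have h1 : 2 * (8388608 * (r : ℝ) ^ 2 * A) * (1 / (128 * A)) / r ^ 2 = 2 ^ 17 := by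
        field_simp; norm_num
      rw [h1]
      have h2 : 4 * (r : ℝ) * (256 * q * (128 * A * (256 * q))) *
          (2 / (A * A * (256 * q)) * (4 * q) ^ j) = 2 ^ 16 * (r * (4 * q) ^ (j + 1)) / A := by
        field_simp; ring
      rw [h2]
      have h3 : (r : ℝ) * (4 * q) ^ (j + 1) ≤ A := by
        rw [hA]
        push_cast
        gcongr
        · have : (1 : ℝ) ≤ q := by exact_mod_cast hq0
          linarith
        · omega
      have h4 : 2 ^ 16 * ((r : ℝ) * (4 * q) ^ (j + 1)) / A ≤ 2 ^ 16 := by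
        rw [div_le_iff₀ hApos]; gcongr
      linarith)
    (by
      have hB := one_add_div_pow_le hr0
      have hDle : D ≤ Z.card := by
        have h1 : D * 64 ≤ D * r ^ 3 := Nat.mul_le_mul_left _ (by
          calc 64 ≤ r := le_trans (by norm_num) hr
            _ = r ^ 1 := (pow_one r).symm
            _ ≤ r ^ 3 := Nat.pow_le_pow_right hr0 (by norm_num))
        omega
      rw [Nat.cast_sub hDle]
      have hDR : (D : ℝ) * r ^ 3 = 2 ^ 23 * A * q ^ 2 := by
        have : (D : ℝ) * r ^ 3 = k * H := by exact_mod_cast hD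
        rw [this, hkR, hHR]; ring
      have hDv : (D : ℝ) = 2 ^ 23 * A * q ^ 2 / r ^ 3 := by
        rw [← hDR]; field_simp
      have h1 : (q / (4 * (r : ℝ))) ^ 2 / (55 * a) ^ 2 ≤
          (q / (4 * (r : ℝ))) ^ 2 / ((1 + 4 / r) ^ r * a) ^ 2 := by gcongr
      -- Here `3025 = 55²`. Of these eight parts `D` needs at most one, as `r ≥ 2 ^ 40`, and the at
      -- most `r * s` chosen points need one more, as `q ≥ r ^ 6`.
      have h2 : (q / (4 * (r : ℝ))) ^ 2 / (55 * a) ^ 2 = 8 * A * q ^ 2 / (3025 * r ^ 2) := by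
        rw [mul_pow, ha2]; field_simp; ring
      have h3 : (D : ℝ) ≤ A * q ^ 2 / (3025 * r ^ 2) := by
        rw [hDv, div_le_div_iff₀ (by positivity) (by positivity)]
        have : (A : ℝ) * q ^ 2 * r ^ 2 * (2 ^ 23 * 3025) ≤ A * q ^ 2 * r ^ 2 * r := by
          gcongr; linarith
        linarith
      have h4 : ((r * (2 ^ 23 * r ^ 2 * A) : ℕ) : ℝ) ≤ A * q ^ 2 / (3025 * r ^ 2) := by
        push_cast
        rw [le_div_iff₀ (by positivity)]
        have h5 : (r : ℝ) ^ 6 ≤ q := by exact_mod_cast hq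
        have h6 : (r : ℝ) * (8388608 * r ^ 2 * A) * (3025 * r ^ 2) = A * r ^ 5 * (2 ^ 23 * 3025) := by
          ring
        have h7 : (1 : ℝ) ≤ q := by exact_mod_cast hq0
        rw [h6]
        have h8 : (2 : ℝ) ^ 23 * 3025 ≤ r := by linarith
        calc (A : ℝ) * (r : ℝ) ^ 5 * ((2 : ℝ) ^ 23 * 3025) ≤ (A : ℝ) * (r : ℝ) ^ 5 * r := by gcongr
          _ = (A : ℝ) * (r : ℝ) ^ 6 := by ring
          _ ≤ (A : ℝ) * q := by gcongr
          _ ≤ (A : ℝ) * (q : ℝ) ^ 2 := by gcongr; exact le_self_pow₀ h7 (by norm_num)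
      have h8 : (A : ℝ) * q ^ 2 / (3025 * r ^ 2) + A * q ^ 2 / (3025 * r ^ 2) ≤
          8 * A * q ^ 2 / (3025 * r ^ 2) := by
        have : 0 ≤ (A : ℝ) * q ^ 2 / (3025 * r ^ 2) := by positivity
        have h9 : 8 * A * (q : ℝ) ^ 2 / (3025 * r ^ 2) = 8 * (A * q ^ 2 / (3025 * r ^ 2)) := by ring
        linarith
      linarith)
  rw [hcardV] at hmain
  refine hmain.mono ?_ le_rfl le_rfl
  intro Y hY
  refine ⟨hY.1, hY.2.1, fun i => lt_of_le_of_lt (Finset.card_le_card ?_) (hY.2.2 i.1)⟩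
  exact Finset.inter_subset_inter (fun u hu => (Finset.mem_inter.1 (he1 i hu)).1) le_rfl

/-- Few containers of density at most `1 / 64` for the sets with fewer than `r` points on each
grid line. -/
theorem coveredBy_freeSets_grid_univ {q r D : ℕ} (hr : 2 ^ 40 ≤ r) (hq : r ^ 6 ≤ q)
    (hA : A = r * (4 * q) ^ (r - 1)) (hk : k = 256 * q) (hH : H = 128 * A * k)
    (hD : D * r ^ 3 = k * H) :
    CoveredBy (freeSets (gridLine (A := A) (k := k) (H := H)) r ∅ Finset.univ) (k * H / 64)
      ((k * H + 1) ^ (r * (2 ^ 23 * r ^ 2 * A) * r ^ 3)) := by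
  classical
  set N := (k * H + 1) ^ (r * (2 ^ 23 * r ^ 2 * A)) with hN
  have hN1 : 1 ≤ N := Nat.one_le_pow _ _ (by omega)
  -- Each round shrinks dense containers by `D`, and the whole grid has `r ^ 3 * D` points.
  suffices H : ∀ t : ℕ, ∀ Z : Finset (Fin k × Fin H), Z.card ≤ t * D →
      CoveredBy (freeSets (gridLine (A := A)) r ∅ Z) (k * H / 64) (N ^ t) by
    have := H (r ^ 3) Finset.univ (by simp [← hD, mul_comm])
    rwa [hN, ← pow_mul] at this
  intro t
  induction t with
  | zero =>
    intro Z hZ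
    rw [pow_zero]
    exact coveredBy_of_subset (C := Z) (by omega) fun Y hY => hY.2.1
  | succ t ih =>
    intro Z hZ
    by_cases hsmall : k * H ≤ 64 * Z.card
    · obtain ⟨𝒞, h1, h2, h3⟩ := coveredBy_freeSets_grid hr hq hA hk hH hD Z hsmall
      refine (coveredBy_biUnion (N := N ^ t) 𝒞 (fun C => freeSets (gridLine (A := A)) r ∅ C)
        ?_ ?_).mono le_rfl le_rfl ?_
      · intro C hC
        refine ih C ((h2 C hC).trans ?_)
        rw [add_mul, one_mul] at hZ
        omega
      · intro Y hY
        obtain ⟨C, hC, hYC⟩ := h3 Y hY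
        exact ⟨C, hC, hY.1, hYC, hY.2.2⟩
      · rw [pow_succ, mul_comm]
        exact Nat.mul_le_mul_left _ h1
    · refine (coveredBy_of_subset (C := Z) (by omega) fun Y hY => hY.2.1).mono le_rfl le_rfl ?_
      exact Nat.one_le_pow _ _ hN1

end Grid

/-! ### Random sampling -/

section Sampling

variable {V J κ : Type*} [Fintype V] [DecidableEq V] [Fintype J] [DecidableEq J] [Fintype κ]

/-- Independence in counting form: the indices in `I` all land in `B` with probability `(|B| / |V|)
^ |I|`. -/
theorem card_maps_into (I : Finset J) (B : Finset V) :
    (Finset.univ.filter fun g : J → V => ∀ i ∈ I, g i ∈ B).card * Fintype.card V ^ I.card =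
      B.card ^ I.card * Fintype.card V ^ Fintype.card J := by
  have h1 : (Finset.univ.filter fun g : J → V => ∀ i ∈ I, g i ∈ B) =
      Fintype.piFinset fun i => if i ∈ I then B else Finset.univ := by
    ext g
    simp only [Finset.mem_filter, Finset.mem_univ, true_and, Fintype.mem_piFinset]
    refine forall_congr' fun i => ?_
    split_ifs with h <;> simp [h]
  rw [h1, Fintype.card_piFinset]
  have h2 : ∀ i, (if i ∈ I then B else Finset.univ).card =
      if i ∈ I then B.card else Fintype.card V := by
    intro i; split_ifs <;> simp
  simp_rw [h2]
  rw [Finset.prod_ite, Finset.prod_const, Finset.prod_const, mul_assoc, ← pow_add]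
  congr 2
  · simp
  · have h3 := Finset.card_filter_add_card_filter_not (s := (Finset.univ : Finset J)) (fun i => i ∈ I)
    have h4 : (Finset.univ.filter fun i => i ∈ I) = I := by simp
    rw [h4, Finset.card_univ] at h3
    omega

/-- The `t`-sets of indices that `g` maps into one of the sets `B b`. -/
noncomputable def clusters (B : κ → Finset V) (t : ℕ) (g : J → V) : Finset (Finset J) :=
  open Classical in (Finset.powersetCard t Finset.univ).filter fun I => ∃ b, ∀ i ∈ I, g i ∈ B b

theorem mem_clusters {B : κ → Finset V} {t : ℕ} {g : J → V} {I : Finset J} :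
    I ∈ clusters B t g ↔ I.card = t ∧ ∃ b, ∀ i ∈ I, g i ∈ B b := by
  simp [clusters, Finset.mem_powersetCard]

theorem sum_card_clusters_le (B : κ → Finset V) (t β : ℕ) (hB : ∀ b, (B b).card ≤ β) :
    (∑ g : J → V, (clusters B t g).card) * Fintype.card V ^ t ≤
      Fintype.card J ^ t * (Fintype.card κ * β ^ t) * Fintype.card V ^ Fintype.card J := by
  classical
  have h1 : ∀ g : J → V, (clusters B t g).card ≤ ∑ I ∈ Finset.powersetCard t Finset.univ,
      ∑ b : κ, if ∀ i ∈ I, g i ∈ B b then 1 else 0 := by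
    intro g
    unfold clusters
    rw [Finset.card_filter]
    refine Finset.sum_le_sum fun I _ => ?_
    split_ifs with h
    · obtain ⟨b, hb⟩ := h
      have := Finset.single_le_sum (f := fun b => if ∀ i ∈ I, g i ∈ B b then 1 else 0)
        (fun _ _ => Nat.zero_le _) (Finset.mem_univ b)
      simpa only [if_pos hb] using this
    · exact Nat.zero_le _
  calc (∑ g : J → V, (clusters B t g).card) * Fintype.card V ^ t
      ≤ (∑ g : J → V, ∑ I ∈ Finset.powersetCard t Finset.univ,
          ∑ b : κ, if ∀ i ∈ I, g i ∈ B b then 1 else 0) * Fintype.card V ^ t :=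
        Nat.mul_le_mul_right _ (Finset.sum_le_sum fun g _ => h1 g)
    _ = ∑ I ∈ Finset.powersetCard t (Finset.univ : Finset J), ∑ b : κ,
          (Finset.univ.filter fun g : J → V => ∀ i ∈ I, g i ∈ B b).card * Fintype.card V ^ t := by
        rw [Finset.sum_comm, Finset.sum_mul]
        refine Finset.sum_congr rfl fun I _ => ?_
        rw [Finset.sum_comm, Finset.sum_mul]
        refine Finset.sum_congr rfl fun b _ => ?_
        rw [Finset.card_filter]
    _ ≤ ∑ I ∈ Finset.powersetCard t (Finset.univ : Finset J), ∑ b : κ,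
          β ^ t * Fintype.card V ^ Fintype.card J := by
        refine Finset.sum_le_sum fun I hI => Finset.sum_le_sum fun b _ => ?_
        have hIt := (Finset.mem_powersetCard.1 hI).2
        have := card_maps_into I (B b)
        rw [hIt] at this
        rw [this]
        exact Nat.mul_le_mul_right _ (Nat.pow_le_pow_left (hB b) t)
    _ = (Fintype.card J).choose t * (Fintype.card κ * β ^ t) * Fintype.card V ^ Fintype.card J := by
        simp only [Finset.sum_const, Finset.card_powersetCard, Finset.card_univ, smul_eq_mul]
        ring
    _ ≤ _ := by
        gcongr
        exact Nat.choose_le_pow _ _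

/-- Few maps send half of the indices into a set of density at most `1 / 64`. -/
theorem card_maps_half_into_le {h : ℕ} (hJ : Fintype.card J = 2 * h) (C : Finset V)
    (hC : 64 * C.card ≤ Fintype.card V) :
    (Finset.univ.filter fun g : J → V => h ≤ (Finset.univ.filter fun i => g i ∈ C).card).card *
      2 ^ (2 * h) * 2 ^ (2 * h) ≤ Fintype.card V ^ (2 * h) := by
  classical
  rcases isEmpty_or_nonempty V with hV | hV
  · rcases Nat.eq_zero_or_pos h with rfl | hh
    · have : IsEmpty J := Fintype.card_eq_zero_iff.1 (by omega)
      simp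
    · have : Nonempty J := Fintype.card_pos_iff.1 (by omega)
      rw [Finset.eq_empty_of_isEmpty (Finset.univ : Finset (J → V))]
      simp
  have hn : 0 < Fintype.card V := Fintype.card_pos
  set n := Fintype.card V
  set F := Finset.univ.filter fun g : J → V => h ≤ (Finset.univ.filter fun i => g i ∈ C).card
  have h1 : F ⊆ (Finset.powersetCard h (Finset.univ : Finset J)).biUnion fun I =>
      Finset.univ.filter fun g : J → V => ∀ i ∈ I, g i ∈ C := by
    intro g hg
    obtain ⟨I, hI, hIc⟩ := Finset.exists_subset_card_eq (Finset.mem_filter.1 hg).2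
    refine Finset.mem_biUnion.2 ⟨I, Finset.mem_powersetCard.2 ⟨Finset.subset_univ _, hIc⟩, ?_⟩
    exact Finset.mem_filter.2 ⟨Finset.mem_univ _, fun i hi => (Finset.mem_filter.1 (hI hi)).2⟩
  have h2 : F.card * n ^ h ≤ 2 ^ (2 * h) * (C.card ^ h * n ^ (2 * h)) := by
    calc F.card * n ^ h ≤ (∑ I ∈ Finset.powersetCard h (Finset.univ : Finset J),
          (Finset.univ.filter fun g : J → V => ∀ i ∈ I, g i ∈ C).card) * n ^ h :=
          Nat.mul_le_mul_right _ ((Finset.card_le_card h1).trans Finset.card_biUnion_le)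
      _ = ∑ I ∈ Finset.powersetCard h (Finset.univ : Finset J), C.card ^ h * n ^ (2 * h) := by
          rw [Finset.sum_mul]
          refine Finset.sum_congr rfl fun I hI => ?_
          have := card_maps_into I C
          rwa [(Finset.mem_powersetCard.1 hI).2, hJ] at this
      _ = (2 * h).choose h * (C.card ^ h * n ^ (2 * h)) := by
          simp [hJ]
      _ ≤ _ := by
          gcongr
          exact Nat.choose_le_two_pow _ _
  have h3 : 64 ^ h * C.card ^ h ≤ n ^ h := by
    rw [← mul_pow]; exact Nat.pow_le_pow_left hC h
  -- The density factor `64 ^ (-h)` pays for the at most `2 ^ (2h)` choices of `h` indices and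
  -- leaves `2 ^ (-4h)`.
  have h4 : (64 : ℕ) ^ h = 2 ^ (2 * h) * 2 ^ (2 * h) * 2 ^ (2 * h) := by
    rw [← pow_add, ← pow_add, show (64 : ℕ) = 2 ^ 6 by norm_num, ← pow_mul]
    congr 1; ring
  have h5 : (F.card * 2 ^ (2 * h) * 2 ^ (2 * h)) * (2 ^ (2 * h) * n ^ h) ≤
      n ^ (2 * h) * (2 ^ (2 * h) * n ^ h) := by
    calc (F.card * 2 ^ (2 * h) * 2 ^ (2 * h)) * (2 ^ (2 * h) * n ^ h)
        = 64 ^ h * (F.card * n ^ h) := by rw [h4]; ring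
      _ ≤ 64 ^ h * (2 ^ (2 * h) * (C.card ^ h * n ^ (2 * h))) := Nat.mul_le_mul_left _ h2
      _ = (64 ^ h * C.card ^ h) * (2 ^ (2 * h) * n ^ (2 * h)) := by ring
      _ ≤ n ^ h * (2 ^ (2 * h) * n ^ (2 * h)) := Nat.mul_le_mul_right _ h3
      _ = _ := by ring
  exact Nat.le_of_mul_le_mul_right h5 (by positivity)

/-- A sparse random sample, after deleting few points, has no more than `r` points on each line and
less than half of its points in each container. -/
theorem exists_sample {h r k : ℕ} (ln : κ → Finset V) (hk : ∀ b, (ln b).card ≤ k) (hh : 0 < h)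
    (𝒞 : Finset (Finset V)) (h𝒞 : 𝒞.card ≤ 2 ^ (2 * h))
    (hC : ∀ C ∈ 𝒞, 64 * C.card ≤ Fintype.card V) (hn : 32 * h ≤ Fintype.card V)
    (hlines : 16 * ((2 * h) ^ (r + 1) * (Fintype.card κ * k ^ (r + 1))) ≤
      2 * h * Fintype.card V ^ (r + 1)) :
    ∃ X : Finset V, X.card ≤ 2 * h ∧ 3 * h ≤ 2 * X.card ∧ (∀ b, (ln b ∩ X).card ≤ r) ∧
      ∀ C ∈ 𝒞, (X ∩ C).card < h := by
  classical
  set n := Fintype.card V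
  have hn0 : 0 < n := by omega
  set m := 2 * h with hm
  -- Coincidences and `(r + 1)`-sets of indices on a line. Their mean is at most `m / 8`, so `E ≤ m
  -- / 4` for at least half of the maps.
  set E : (Fin m → V) → ℕ := fun g =>
    (clusters (fun v : V => ({v} : Finset V)) 2 g).card + (clusters ln (r + 1) g).card with hE
  have hEsum : 8 * ∑ g, E g ≤ m * n ^ m := by
    have h1 := sum_card_clusters_le (J := Fin m) (fun v : V => ({v} : Finset V)) 2 1 (by simp)
    have h2 := sum_card_clusters_le (J := Fin m) ln (r + 1) k hk
    rw [Fintype.card_fin] at h1 h2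
    have h3 : 16 * ∑ g : Fin m → V, (clusters (fun v : V => ({v} : Finset V)) 2 g).card ≤
        m * n ^ m := by
      refine le_of_mul_le_mul_right (a := n ^ 2) ?_ (by positivity)
      calc _ = 16 * ((∑ g : Fin m → V, (clusters (fun v : V => ({v} : Finset V)) 2 g).card) *
            n ^ 2) := by ring
        _ ≤ 16 * (m ^ 2 * (n * 1 ^ 2) * n ^ m) := Nat.mul_le_mul_left _ h1
        _ = 16 * m * (m * n * n ^ m) := by ring
        _ ≤ n * (m * n * n ^ m) := Nat.mul_le_mul_right _ (by omega)
        _ = _ := by ring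
    have h4 : 16 * ∑ g : Fin m → V, (clusters ln (r + 1) g).card ≤ m * n ^ m := by
      refine le_of_mul_le_mul_right (a := n ^ (r + 1)) ?_ (by positivity)
      calc _ = 16 * ((∑ g : Fin m → V, (clusters ln (r + 1) g).card) * n ^ (r + 1)) := by ring
        _ ≤ 16 * (m ^ (r + 1) * (Fintype.card κ * k ^ (r + 1)) * n ^ m) := Nat.mul_le_mul_left _ h2
        _ = 16 * (m ^ (r + 1) * (Fintype.card κ * k ^ (r + 1))) * n ^ m := by ring
        _ ≤ m * n ^ (r + 1) * n ^ m := Nat.mul_le_mul_right _ hlines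
        _ = _ := by ring
    simp only [hE, Finset.sum_add_distrib]
    omega
  set B1 : Finset (Fin m → V) := Finset.univ.filter fun g => m < 4 * E g with hB1
  set B2 : Finset (Fin m → V) := 𝒞.biUnion fun C =>
    Finset.univ.filter fun g => h ≤ (Finset.univ.filter fun i => g i ∈ C).card with hB2
  have hB1c : 2 * B1.card ≤ n ^ m := by
    have h1 : B1.card * m ≤ ∑ g, 4 * E g := by
      calc B1.card * m = ∑ g ∈ B1, m := by simp
        _ ≤ ∑ g ∈ B1, 4 * E g := Finset.sum_le_sum fun g hg => (Finset.mem_filter.1 hg).2.le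
        _ ≤ _ := Finset.sum_le_sum_of_subset (Finset.subset_univ _)
    rw [← Finset.mul_sum] at h1
    refine le_of_mul_le_mul_right (a := m) ?_ (by omega)
    calc 2 * B1.card * m = 2 * (B1.card * m) := by ring
      _ ≤ 2 * (4 * ∑ g, E g) := Nat.mul_le_mul_left _ h1
      _ = 8 * ∑ g, E g := by ring
      _ ≤ _ := hEsum.trans_eq (mul_comm _ _)
  have hB2c : 4 * B2.card ≤ n ^ m := by
    have h1 : B2.card * 2 ^ m * 2 ^ m ≤ 2 ^ m * n ^ m := by
      calc B2.card * 2 ^ m * 2 ^ m ≤ (∑ C ∈ 𝒞, (Finset.univ.filter fun g : Fin m → V =>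
            h ≤ (Finset.univ.filter fun i => g i ∈ C).card).card) * 2 ^ m * 2 ^ m := by
            gcongr; exact Finset.card_biUnion_le
        _ = ∑ C ∈ 𝒞, (Finset.univ.filter fun g : Fin m → V =>
            h ≤ (Finset.univ.filter fun i => g i ∈ C).card).card * 2 ^ m * 2 ^ m := by
            rw [Finset.sum_mul, Finset.sum_mul]
        _ ≤ ∑ C ∈ 𝒞, n ^ m := Finset.sum_le_sum fun C hCm =>
            card_maps_half_into_le (by simp [hm]) C (hC C hCm)
        _ = 𝒞.card * n ^ m := by simp
        _ ≤ _ := Nat.mul_le_mul_right _ h𝒞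
    have h2 : B2.card * 2 ^ m ≤ n ^ m := by
      refine le_of_mul_le_mul_right (a := 2 ^ m) ?_ (by positivity)
      rw [mul_comm (n ^ m)]; exact h1
    have h3 : 4 ≤ 2 ^ m := by
      calc 4 = 2 ^ 2 := by norm_num
        _ ≤ 2 ^ m := Nat.pow_le_pow_right (by norm_num) (by omega)
    calc 4 * B2.card ≤ 2 ^ m * B2.card := Nat.mul_le_mul_right _ h3
      _ ≤ _ := by rw [mul_comm]; exact h2
  obtain ⟨g, hg⟩ : ∃ g, g ∉ B1 ∪ B2 := by
    by_contra hcon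
    push Not at hcon
    have h1 : (Finset.univ : Finset (Fin m → V)).card ≤ (B1 ∪ B2).card :=
      Finset.card_le_card fun g _ => hcon g
    have h2 := Finset.card_union_le B1 B2
    have h3 : (Finset.univ : Finset (Fin m → V)).card = n ^ m := by simp [n]
    have h4 : 0 < n ^ m := by positivity
    omega
  rw [Finset.notMem_union] at hg
  obtain ⟨hg1, hg2⟩ := hg
  have hEg : 4 * E g ≤ m := by
    by_contra hcon
    exact hg1 (Finset.mem_filter.2 ⟨Finset.mem_univ _, not_le.1 hcon⟩)
  have hCg : ∀ C ∈ 𝒞, (Finset.univ.filter fun i => g i ∈ C).card < h := by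
    intro C hCm
    by_contra hcon
    exact hg2 (Finset.mem_biUnion.2 ⟨C, hCm,
      Finset.mem_filter.2 ⟨Finset.mem_univ _, not_lt.1 hcon⟩⟩)
  set 𝒦 : Finset (Finset (Fin m)) :=
    clusters (fun v : V => ({v} : Finset V)) 2 g ∪ clusters ln (r + 1) g with h𝒦
  have h𝒦c : 𝒦.card ≤ E g := Finset.card_union_le _ _
  have h𝒦ne : ∀ I ∈ 𝒦, ∃ i, i ∈ I := by
    intro I hI
    have : 0 < I.card := by
      rcases Finset.mem_union.1 hI with hI | hI <;> rw [(mem_clusters.1 hI).1] <;> omega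
    exact Finset.card_pos.1 this
  have hm0 : 0 < m := by omega
  have : Nonempty (Fin m) := ⟨⟨0, hm0⟩⟩
  choose! φ hφ using h𝒦ne
  -- Dropping one index from each bad cluster destroys all of them and keeps at least `3m / 4`
  -- indices.
  set T : Finset (Fin m) := Finset.univ \ 𝒦.image φ with hT
  have hTfree : ∀ I ⊆ T, I ∉ 𝒦 := by
    intro I hIT hI
    have := hIT (hφ I hI)
    exact (Finset.mem_sdiff.1 this).2 (Finset.mem_image_of_mem φ hI)
  have hTc : m ≤ T.card + E g := by
    have h1 : (Finset.univ : Finset (Fin m)).card - (𝒦.image φ).card ≤ T.card :=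
      Finset.le_card_sdiff _ _
    have h2 : (𝒦.image φ).card ≤ 𝒦.card := Finset.card_image_le
    rw [Finset.card_univ, Fintype.card_fin] at h1
    omega
  have hinj : Set.InjOn g T := by
    intro i hi j hj hij
    by_contra hne
    refine hTfree {i, j} ?_ (Finset.mem_union_left _ (mem_clusters.2
      ⟨Finset.card_pair hne, g i, ?_⟩))
    · intro x hx
      rcases Finset.mem_insert.1 hx with rfl | hx
      · exact hi
      · rw [Finset.mem_singleton.1 hx]; exact hj
    · intro x hx
      rcases Finset.mem_insert.1 hx with rfl | hx
      · simp
      · rw [Finset.mem_singleton.1 hx]; simp [hij]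
  refine ⟨T.image g, ?_, ?_, ?_, ?_⟩
  · exact Finset.card_image_le.trans ((Finset.card_le_univ _).trans (by simp))
  · rw [Finset.card_image_of_injOn hinj]; omega
  · intro b
    by_contra hcon
    push Not at hcon
    have h1 : ln b ∩ T.image g ⊆ (T.filter fun i => g i ∈ ln b).image g := by
      intro v hv
      obtain ⟨hvb, hvT⟩ := Finset.mem_inter.1 hv
      obtain ⟨i, hi, rfl⟩ := Finset.mem_image.1 hvT
      exact Finset.mem_image_of_mem g (Finset.mem_filter.2 ⟨hi, hvb⟩)
    have h2 : r + 1 ≤ (T.filter fun i => g i ∈ ln b).card :=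
      (Nat.succ_le_of_lt hcon).trans ((Finset.card_le_card h1).trans Finset.card_image_le)
    obtain ⟨I, hI, hIc⟩ := Finset.exists_subset_card_eq h2
    exact hTfree I (hI.trans (Finset.filter_subset _ _)) (Finset.mem_union_right _
      (mem_clusters.2 ⟨hIc, b, fun i hi => (Finset.mem_filter.1 (hI hi)).2⟩))
  · intro C hCm
    refine lt_of_le_of_lt ?_ (hCg C hCm)
    have h1 : T.image g ∩ C ⊆ (Finset.univ.filter fun i => g i ∈ C).image g := by
      intro v hv
      obtain ⟨hvT, hvC⟩ := Finset.mem_inter.1 hv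
      obtain ⟨i, hi, rfl⟩ := Finset.mem_image.1 hvT
      exact Finset.mem_image_of_mem g (Finset.mem_filter.2 ⟨Finset.mem_univ _, hvC⟩)
    exact (Finset.card_le_card h1).trans Finset.card_image_le

end Sampling

/-! ### The planar point set -/

/-- Explains `q = r ^ (12 r)`: as `A` contains `q ^ (r - 1)`, a single factor `q` must make
collinear `(r + 1)`-sets rare. -/
theorem sixteen_mul_pow_le {r : ℕ} (hr : 2 ^ 40 ≤ r) :
    16 * (2 ^ 8 * r ^ 9) ^ r * (r * 4 ^ (r - 1)) ≤ r ^ (12 * r) := by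
  have hr0 : 0 < r := lt_of_lt_of_le (by norm_num) hr
  have h1 : (2 ^ 8 * r ^ 9) ^ r ≤ r ^ (10 * r) := by
    rw [pow_mul]
    refine Nat.pow_le_pow_left ?_ r
    rw [pow_succ' r 9]
    exact Nat.mul_le_mul_right _ (le_trans (by norm_num) hr)
  have h2 : 4 ^ (r - 1) ≤ r ^ (r - 1) := Nat.pow_le_pow_left (le_trans (by norm_num) hr) _
  calc 16 * (2 ^ 8 * r ^ 9) ^ r * (r * 4 ^ (r - 1))
      ≤ r * r ^ (10 * r) * (r * r ^ (r - 1)) := by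
        gcongr
        exact le_trans (by norm_num) hr
    _ = r ^ (1 + 10 * r + (1 + (r - 1))) := by rw [pow_add, pow_add, pow_add, pow_one]
    _ ≤ r ^ (12 * r) := Nat.pow_le_pow_right hr0 (by omega)

/-- The logarithm of the grid size is of order at most `r² log r`, because `A` is nearly `q ^ r`.
This produces the square root and the double logarithm in the result. -/
theorem grid_card_succ_le {r A k H : ℕ} (hr : 2 ^ 40 ≤ r)
    (hA : A = r * (4 * r ^ (12 * r)) ^ (r - 1)) (hk : k = 256 * r ^ (12 * r))
    (hH : H = 128 * A * k) : k * H + 1 ≤ r ^ (13 * r ^ 2) := by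
  have hr0 : 0 < r := lt_of_lt_of_le (by norm_num) hr
  have hkH : k * H = 2 ^ 23 * (r * 4 ^ (r - 1) * r ^ (12 * r * (r - 1))) * r ^ (24 * r) := by
    rw [hH, hk, hA, mul_pow, ← pow_mul, show 24 * r = 12 * r + 12 * r by ring, pow_add]
    ring
  have h0 : 0 < k * H := by rw [hkH]; positivity
  have h2 : 4 ^ (r - 1) ≤ r ^ (r - 1) := Nat.pow_le_pow_left (le_trans (by norm_num) hr) _
  obtain ⟨t, rfl⟩ : ∃ t, r = t + 1 := ⟨r - 1, by omega⟩
  have ht : 2 ^ 39 ≤ t := by norm_num at hr ⊢; omega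
  set r := t + 1 with hrt
  calc k * H + 1 ≤ 2 * (k * H) := by omega
    _ = 2 ^ 24 * (r * 4 ^ (r - 1) * r ^ (12 * r * (r - 1))) * r ^ (24 * r) := by rw [hkH]; ring
    _ ≤ r * (r * r ^ (r - 1) * r ^ (12 * r * (r - 1))) * r ^ (24 * r) := by
        gcongr
        exact le_trans (by norm_num) hr
    _ = r ^ (1 + (1 + (r - 1) + 12 * r * (r - 1)) + 24 * r) := by
        rw [pow_add, pow_add, pow_add, pow_add, pow_one]
    _ ≤ r ^ (13 * r ^ 2) := by
        refine Nat.pow_le_pow_right hr0 ?_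
        have : r - 1 = t := by omega
        rw [this, hrt]
        nlinarith

/-- A subset of a grid with at most `r` points on each grid line, such that every subset with half
of the points contains `r` points of some grid line. -/
theorem exists_grid_subset {r : ℕ} (hr : 2 ^ 40 ≤ r) (hr2 : r ^ 13 ≤ 2 ^ r) :
    ∃ (A k H h : ℕ) (X : Finset (Fin k × Fin H)), X.card ≤ r ^ (13 * r ^ 2) ∧ r ^ 9 ≤ h ∧
      3 * h ≤ 2 * X.card ∧ (∀ i : Fin A × Fin H, (gridLine i ∩ X).card ≤ r) ∧
      ∀ Y ⊆ X, h ≤ Y.card → ∃ i : Fin A × Fin H, r ≤ (gridLine i ∩ Y).card := by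
  classical
  have hr0 : 0 < r := lt_of_lt_of_le (by norm_num) hr
  obtain ⟨q, hq⟩ : ∃ q, q = r ^ (12 * r) := ⟨_, rfl⟩
  obtain ⟨A, hA⟩ : ∃ A, A = r * (4 * q) ^ (r - 1) := ⟨_, rfl⟩
  obtain ⟨k, hk⟩ : ∃ k, k = 256 * q := ⟨_, rfl⟩
  obtain ⟨H, hH⟩ : ∃ H, H = 128 * A * k := ⟨_, rfl⟩
  -- Chosen so that `2h = r * (2 ^ 23 r² A) * r³ * r³`: the exponent in the container count times
  -- `r³`, since `k * H + 1 ≤ 2 ^ r ^ 3`.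
  obtain ⟨h, hh⟩ : ∃ h, h = 2 ^ 22 * r ^ 9 * A := ⟨_, rfl⟩
  have hq0 : 0 < q := by rw [hq]; positivity
  have hA0 : 0 < A := by rw [hA]; positivity
  have hq12 : r ^ 12 ≤ q := by rw [hq]; exact Nat.pow_le_pow_right hr0 (by omega)
  have hcard := grid_card_succ_le hr (by rw [hA, hq]) (by rw [hk, hq]) hH
  have hD : (2 ^ 23 * A * r ^ (24 * r - 3)) * r ^ 3 = k * H := by
    have h1 : r ^ (24 * r - 3) * r ^ 3 = q ^ 2 := by
      rw [hq, ← pow_add, ← pow_mul]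
      congr 1
      omega
    rw [mul_assoc, h1, hH, hk]
    ring
  obtain ⟨𝒞, hC1, hC2, hC3⟩ := coveredBy_freeSets_grid_univ hr
    ((Nat.pow_le_pow_right hr0 (by norm_num)).trans hq12) hA hk hH hD
  have h𝒞 : 𝒞.card ≤ 2 ^ (2 * h) := by
    refine hC1.trans ?_
    have h1 : k * H + 1 ≤ 2 ^ r ^ 3 := by
      refine hcard.trans ?_
      rw [pow_mul]
      refine (Nat.pow_le_pow_left hr2 _).trans (le_of_eq ?_)
      rw [← pow_mul]
      congr 1
      ring
    refine (Nat.pow_le_pow_left h1 _).trans (le_of_eq ?_)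
    rw [← pow_mul]
    congr 1
    rw [hh]
    ring
  have hV : Fintype.card (Fin k × Fin H) = k * H := by simp
  have hκ : Fintype.card (Fin A × Fin H) = A * H := by simp
  have hkH : k * H = 2 ^ 23 * A * q ^ 2 := by rw [hH, hk]; ring
  obtain ⟨X, hX1, hX2, hX3, hX4⟩ := exists_sample (V := Fin k × Fin H) (h := h) (r := r) (k := k)
    (gridLine (A := A)) card_gridLine_le (by rw [hh]; positivity) 𝒞 h𝒞
    (by
      intro C hC
      have := hC2 C hC
      rw [hV]
      omega)
    (by
      rw [hV, hkH, hh]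
      have h1 : 16 * r ^ 9 ≤ q ^ 2 := by
        calc 16 * r ^ 9 ≤ r * r ^ 9 := Nat.mul_le_mul_right _ (le_trans (by norm_num) hr)
          _ = r ^ 10 := by ring
          _ ≤ r ^ 12 := Nat.pow_le_pow_right hr0 (by norm_num)
          _ ≤ q := hq12
          _ ≤ q ^ 2 := Nat.le_self_pow (by norm_num) q
      calc 32 * (2 ^ 22 * r ^ 9 * A) = 2 ^ 23 * A * (16 * r ^ 9) := by ring
        _ ≤ _ := Nat.mul_le_mul_left _ h1)
    (by
      rw [hV, hκ]
      have h1 : 16 * (2 ^ 8 * r ^ 9) ^ r * A ≤ q ^ r := by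
        have h2 := sixteen_mul_pow_le hr
        rw [← hq] at h2
        calc 16 * (2 ^ 8 * r ^ 9) ^ r * A
            = (16 * (2 ^ 8 * r ^ 9) ^ r * (r * 4 ^ (r - 1))) * q ^ (r - 1) := by
              rw [hA, mul_pow]; ring
          _ ≤ q * q ^ (r - 1) := Nat.mul_le_mul_right _ h2
          _ = q ^ r := by rw [← pow_succ']; congr 1; omega
      have h3 : 16 * (2 * h) ^ r * A ≤ H ^ r := by
        have h4 : 2 * h = 2 ^ 15 * A * (2 ^ 8 * r ^ 9) := by rw [hh]; ring
        have h5 : H = 2 ^ 15 * A * q := by rw [hH, hk]; ring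
        rw [h4, h5, mul_pow _ (2 ^ 8 * r ^ 9), mul_pow _ q]
        calc 16 * ((2 ^ 15 * A) ^ r * (2 ^ 8 * r ^ 9) ^ r) * A
            = (2 ^ 15 * A) ^ r * (16 * (2 ^ 8 * r ^ 9) ^ r * A) := by ring
          _ ≤ _ := Nat.mul_le_mul_left _ h1
      calc 16 * ((2 * h) ^ (r + 1) * (A * H * k ^ (r + 1)))
          = (16 * (2 * h) ^ r * A) * (2 * h * H * k ^ (r + 1)) := by ring
        _ ≤ H ^ r * (2 * h * H * k ^ (r + 1)) := Nat.mul_le_mul_right _ h3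
        _ = _ := by rw [mul_pow]; ring)
  refine ⟨A, k, H, h, X, ?_, ?_, hX2, hX3, ?_⟩
  · have := Finset.card_le_univ X
    rw [hV] at this
    omega
  · rw [hh]
    calc r ^ 9 = 1 * r ^ 9 * 1 := by ring
      _ ≤ _ := by gcongr <;> omega
  · intro Y hYX hYh
    by_contra hcon
    push Not at hcon
    obtain ⟨C, hC, hYC⟩ := hC3 Y ⟨Finset.empty_subset _, Finset.subset_univ _, hcon⟩
    have h1 := hX4 C hC
    have h2 := Finset.card_le_card (Finset.subset_inter hYX hYC)
    omega

/-- The embedding of the grid in the plane. -/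
noncomputable def gridPoint {k H : ℕ} (z : Fin k × Fin H) : EuclideanSpace ℝ (Fin 2) :=
  !₂[((z.1 : ℕ) : ℝ), ((z.2 : ℕ) : ℝ)]

theorem gridPoint_injective {k H : ℕ} : Function.Injective (gridPoint (k := k) (H := H)) := by
  intro z z' h
  have h0 := congrArg (fun v : EuclideanSpace ℝ (Fin 2) => v 0) h
  have h1 := congrArg (fun v : EuclideanSpace ℝ (Fin 2) => v 1) h
  simp only [gridPoint, PiLp.toLp_apply, Matrix.cons_val_zero, Matrix.cons_val_one] at h0 h1
  exact Prod.ext (Fin.ext (by exact_mod_cast h0)) (Fin.ext (by exact_mod_cast h1))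

/-- The line `y = a x + b` in the plane. -/
noncomputable def planeLine (a b : ℝ) : AffineSubspace ℝ (EuclideanSpace ℝ (Fin 2)) :=
  AffineSubspace.mk' !₂[0, b] (Submodule.span ℝ {!₂[1, a]})

theorem finrank_direction_planeLine (a b : ℝ) :
    Module.finrank ℝ (planeLine a b).direction = 1 := by
  rw [planeLine, AffineSubspace.direction_mk']
  refine finrank_span_singleton fun h => ?_
  have := congrArg (fun v : EuclideanSpace ℝ (Fin 2) => v 0) h
  simp at this

theorem gridPoint_mem_planeLine {A k H : ℕ} {i : Fin A × Fin H} {z : Fin k × Fin H} :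
    gridPoint z ∈ planeLine (i.1 : ℕ) (i.2 : ℕ) ↔ z ∈ gridLine i := by
  rw [planeLine, AffineSubspace.mem_mk', Submodule.mem_span_singleton, mem_gridLine]
  constructor
  · rintro ⟨c, hc⟩
    have h0 := congrArg (fun v : EuclideanSpace ℝ (Fin 2) => v 0) hc
    have h1 := congrArg (fun v : EuclideanSpace ℝ (Fin 2) => v 1) hc
    simp [gridPoint] at h0 h1
    rw [h0] at h1
    have : ((z.2 : ℕ) : ℝ) = (i.1 : ℕ) * (z.1 : ℕ) + (i.2 : ℕ) := by linarith
    exact_mod_cast this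
  · intro h
    have h' : ((z.2 : ℕ) : ℝ) = (i.1 : ℕ) * (z.1 : ℕ) + (i.2 : ℕ) := by exact_mod_cast h
    refine ⟨((z.1 : ℕ) : ℝ), ?_⟩
    ext j
    fin_cases j
    · simp [gridPoint]
    · simp [gridPoint, h', mul_comm]

theorem image_gridLine_mem_lineRanges {A k H : ℕ} (X : Finset (Fin k × Fin H))
    (i : Fin A × Fin H) :
    (gridLine i ∩ X).map ⟨gridPoint, gridPoint_injective⟩ ∈
      lineRanges (X.map ⟨gridPoint, gridPoint_injective⟩) := by
  refine ⟨planeLine (i.1 : ℕ) (i.2 : ℕ), finrank_direction_planeLine _ _, ?_⟩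
  ext p
  simp only [Finset.coe_map, Function.Embedding.coeFn_mk, Set.mem_image,
    Finset.mem_inter, Set.mem_inter_iff, SetLike.mem_coe]
  constructor
  · rintro ⟨z, ⟨hzi, hzX⟩, rfl⟩
    exact ⟨⟨z, hzX, rfl⟩, gridPoint_mem_planeLine.2 hzi⟩
  · rintro ⟨⟨z, hzX, rfl⟩, hz⟩
    exact ⟨z, ⟨gridPoint_mem_planeLine.1 hz, hzX⟩, rfl⟩

/-- A net for the lines with `r` points contains a quarter of the points. -/
theorem card_le_four_mul_card_of_isEpsNet {A k H h r : ℕ} {X : Finset (Fin k × Fin H)}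
    (hX0 : X.Nonempty) (hh : 3 * h ≤ 2 * X.card)
    (hXr : ∀ i : Fin A × Fin H, (gridLine i ∩ X).card ≤ r)
    (hXY : ∀ Y ⊆ X, h ≤ Y.card → ∃ i : Fin A × Fin H, r ≤ (gridLine i ∩ Y).card)
    {N : Finset (EuclideanSpace ℝ (Fin 2))}
    (hN : IsEpsNet (r / X.card) (X.map ⟨gridPoint, gridPoint_injective⟩)
      (lineRanges (X.map ⟨gridPoint, gridPoint_injective⟩)) N) : X.card ≤ 4 * N.card := by
  classical
  by_contra hcon
  push Not at hcon
  set Y := X.filter fun z => gridPoint z ∉ N with hY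
  have h1 : X.card ≤ Y.card + N.card := by
    rw [← Finset.card_filter_add_card_filter_not (s := X) (fun z => gridPoint z ∉ N)]
    refine Nat.add_le_add_left (Finset.card_le_card_of_injOn gridPoint ?_
      gridPoint_injective.injOn) _
    intro z hz
    have := (Finset.mem_filter.1 hz).2
    exact not_not.1 this
  have hYX : Y ⊆ X := Finset.filter_subset _ _
  -- A net smaller than `|X| / 4` leaves more than `3|X| / 4 ≥ h` points. The line found has at most
  -- `r` points in `X`, so all of them lie in `Y`, off the net.
  obtain ⟨i, hi⟩ := hXY Y hYX (by omega)
  have heq : gridLine i ∩ Y = gridLine i ∩ X :=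
    Finset.eq_of_subset_of_card_le (Finset.inter_subset_inter le_rfl hYX) ((hXr i).trans hi)
  have hXpos : (0 : ℝ) < X.card := by exact_mod_cast hX0.card_pos
  obtain ⟨p, hpN, hp⟩ := hN.2 _ (image_gridLine_mem_lineRanges X i) (by
    rw [Finset.card_map, Finset.card_map, div_mul_cancel₀ _ hXpos.ne', ← heq]
    exact_mod_cast hi)
  obtain ⟨z, hz, rfl⟩ := Finset.mem_map.1 hp
  rw [← heq] at hz
  exact (Finset.mem_filter.1 (Finset.mem_inter.1 hz).2).2 hpN

/-! ### Calibration of `r` against `ε`, and the theorem -/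

theorem sqrt_log_div_log_log_le {r : ℕ} {t : ℝ} (hr : 2 ^ 40 ≤ r) (h1 : (r : ℝ) ^ 8 ≤ t)
    (h2 : t ≤ (r : ℝ) ^ (13 * r ^ 2)) :
    √(Real.log t / Real.log (Real.log t)) ≤ 20 * r := by
  have hr' : (2 : ℝ) ^ 40 ≤ r := by exact_mod_cast hr
  have hr0 : (0 : ℝ) < r := lt_of_lt_of_le (by norm_num) hr'
  have ht0 : 0 < t := lt_of_lt_of_le (by positivity) h1
  have he : Real.exp 1 ≤ r := by
    have := Real.exp_one_lt_d9
    linarith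
  have hlr : 1 ≤ Real.log r := by
    rw [Real.le_log_iff_exp_le hr0]; exact he
  have hx1 : 8 * Real.log r ≤ Real.log t := by
    have := Real.log_le_log (by positivity) h1
    rw [Real.log_pow] at this
    exact_mod_cast this
  have hx2 : Real.log t ≤ 13 * r ^ 2 * Real.log r := by
    have := Real.log_le_log ht0 h2
    rw [Real.log_pow] at this
    push_cast at this
    exact this
  set x := Real.log t with hx
  have hx0 : 0 < x := by linarith
  have hlx : 1 ≤ Real.log x := by
    rw [Real.le_log_iff_exp_le hx0]
    have := Real.exp_one_lt_d9
    linarith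
  rw [Real.sqrt_le_left (by positivity), div_le_iff₀ (by linarith)]
  -- For `x ≤ r²` the bound `log x ≥ 1` suffices; otherwise `log x ≥ 2 log r` cancels the factor
  -- `log r` of `hx2`.
  by_cases hc : x ≤ (r : ℝ) ^ 2
  · nlinarith [sq_nonneg (r : ℝ)]
  · push Not at hc
    have h3 : 2 * Real.log r ≤ Real.log x := by
      have := Real.log_le_log (by positivity) hc.le
      rw [Real.log_pow] at this
      exact_mod_cast this
    nlinarith [sq_nonneg (r : ℝ), mul_le_mul_of_nonneg_left h3 (sq_nonneg (r : ℝ))]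

theorem exists_large_nat (c : ℝ) : ∃ r : ℕ, 2 ^ 40 ≤ r ∧ r ^ 13 ≤ 2 ^ r ∧ c < r := by
  obtain ⟨c', hc'⟩ := exists_nat_gt c
  refine ⟨2 ^ (c' + 40), ?_, ?_, ?_⟩
  · exact Nat.pow_le_pow_right (by norm_num) (by omega)
  · rw [← pow_mul]
    refine Nat.pow_le_pow_right (by norm_num) ?_
    have h1 : c' + 36 < 2 ^ (c' + 36) := Nat.lt_two_pow_self
    rw [show c' + 40 = c' + 36 + 4 by ring, pow_add]
    omega
  · have h1 : c' < 2 ^ c' := Nat.lt_two_pow_self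
    have h2 : 2 ^ c' ≤ 2 ^ (c' + 40) := Nat.pow_le_pow_right (by norm_num) (by omega)
    have h3 : (c' : ℝ) < (2 ^ (c' + 40) : ℕ) := by exact_mod_cast h1.trans_le h2
    linarith

theorem theorem1p3 (ε₀ : ℝ) (hε₀ : 0 < ε₀) :
    ∃ ε : ℝ, 0 < ε ∧ ε < ε₀ ∧
      ∃ X : Finset (EuclideanSpace ℝ (Fin 2)), X.Nonempty ∧
        ∃ k : ℕ,
          IsLeast {j : ℕ | ∃ N : Finset (EuclideanSpace ℝ (Fin 2)),
            IsEpsNet ε X (lineRanges X) N ∧ N.card = j} k ∧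
          1 / (80 * ε) * √(Real.log (1 / ε) / Real.log (Real.log (1 / ε))) ≤ (k : ℝ) := by
  obtain ⟨r, hr, hr2, hrε⟩ := exists_large_nat (1 / ε₀)
  obtain ⟨A, k, H, h, X, hXle, hh, hXh, hXr, hXY⟩ := exists_grid_subset hr hr2
  have hr' : (2 : ℝ) ^ 40 ≤ r := by exact_mod_cast hr
  have hr0 : (0 : ℝ) < r := lt_of_lt_of_le (by norm_num) hr'
  have hr9 : r ^ 9 ≤ X.card := by omega
  have hX9 : (r : ℝ) ^ 9 ≤ X.card := by exact_mod_cast hr9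
  have hXpos : (0 : ℝ) < X.card := lt_of_lt_of_le (by positivity) hX9
  have hXne : X.Nonempty := Finset.card_pos.1 (by exact_mod_cast hXpos)
  have hε : (0 : ℝ) < r / X.card := by positivity
  set X' := X.map ⟨gridPoint, gridPoint_injective⟩ with hX'
  have hX'c : X'.card = X.card := Finset.card_map _
  refine ⟨r / X.card, hε, ?_, X', hXne.map, ?_⟩
  · have h1 : 1 < r * ε₀ := by rwa [div_lt_iff₀ hε₀] at hrε
    rw [div_lt_iff₀ hXpos]
    have h2 : (r : ℝ) ^ 2 ≤ X.card :=
      (pow_le_pow_right₀ (by linarith) (by norm_num)).trans hX9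
    calc (r : ℝ) = 1 * r := by ring
      _ < r * ε₀ * r := by gcongr
      _ = ε₀ * r ^ 2 := by ring
      _ ≤ ε₀ * X.card := by gcongr
  · set J := {j : ℕ | ∃ N : Finset (EuclideanSpace ℝ (Fin 2)),
      IsEpsNet (r / X.card) X' (lineRanges X') N ∧ N.card = j} with hJ
    -- Needed because `sInf ∅ = 0`. The whole of `X'` is a net, since `ε |X'| = r > 0` makes heavy
    -- ranges nonempty.
    have hJne : J.Nonempty := by
      refine ⟨X'.card, X', ⟨subset_rfl, ?_⟩, rfl⟩
      rintro B ⟨L, _, hB⟩ hBc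
      have h1 : (0 : ℝ) < B.card := by
        refine lt_of_lt_of_le ?_ hBc
        rw [hX'c]; positivity
      obtain ⟨x, hx⟩ := Finset.card_pos.1 (by exact_mod_cast h1 : 0 < B.card)
      have hx' : x ∈ (B : Set (EuclideanSpace ℝ (Fin 2))) := hx
      rw [hB] at hx'
      exact ⟨x, hx'.1, hx⟩
    refine ⟨sInf J, ⟨Nat.sInf_mem hJne, fun j hj => Nat.sInf_le hj⟩, ?_⟩
    obtain ⟨N, hN, hNc⟩ := Nat.sInf_mem hJne
    rw [← hNc]
    have h4 := card_le_four_mul_card_of_isEpsNet hXne hXh hXr hXY hN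
    have h4' : (X.card : ℝ) ≤ 4 * N.card := by exact_mod_cast h4
    have hinv : 1 / ((r : ℝ) / X.card) = X.card / r := by rw [one_div_div]
    have hlog := sqrt_log_div_log_log_le (t := X.card / r) hr
      (by rw [le_div_iff₀ hr0, ← pow_succ]; exact hX9)
      (by
        refine (div_le_self hXpos.le (by linarith)).trans ?_
        exact_mod_cast hXle)
    rw [hinv]
    -- The constant `80` arises as `4 * 20`: a quarter of the points, and the factor in `hlog`.
    calc 1 / (80 * ((r : ℝ) / X.card)) * √(Real.log (X.card / r) / Real.log (Real.log (X.card / r)))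
        ≤ 1 / (80 * ((r : ℝ) / X.card)) * (20 * r) := by gcongr
      _ = X.card / 4 := by field_simp; norm_num
      _ ≤ N.card := by linarith
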